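/- **Theorem 3.3.** Let $p$ and $q$ be primes with $p\equiv 1\pmod 4$ and $q\equiv 3\pmod 8$. Let $c,d,x,y,m\in\mathbb Z$ satisfy $$p=c^2+d^2,\qquad 4p=x^2+qy^2,\qquad c\equiv y\equiv 1\pmod 4,$$ and assume that $\gcd(c,x+2d)=1$ or $\gcd(d,x+2c)=1$. Suppose that $$\Big(\frac{2(c-di)}{x}\Big)^{\frac{q+1}4}\equiv i^m\pmod q,$$ where $i=\sqrt{-1}$ and the congruence is taken in the ring of fractions $\gamma/t$ with $\gamma\in\mathbb Z[i]$ and $t\in\mathbb Z$ prime to $q$ (note that $q\nmid x$). Then $$(-q)^{\lfloor p/8\rfloor}\equiv\begin{cases}(-1)^{\lfloor x/4\rfloor+1}\left(\dfrac dc\right)^m\pmod p&\text{if }p\equiv 1\pmod 8,\\[2mm](-1)^{\frac{x^2-1}8}\left(\dfrac dc\right)^m\dfrac yx\pmod p&\text{if }p\equiv 5\pmod 8,\end{cases}$$ where $d/c$ and $y/x$ are quotients modulo $p$ (note that $p\nmid cdx$). -/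

import Mathlib

/-- Congruence modulo a rational integer `n` between complex numbers (in practice elements of
`ℚ(i)`, written as fractions): `α ≡ β (mod n)` in the ring of fractions of `ℤ[i]` whose denominators
are rational integers prime to `n`. It says that `α - β = n * γ / t` for some `γ ∈ ℤ[i]` and
some integer `t` prime to `n`. -/
def GaussianCongr (n : ℤ) (α β : ℂ) : Prop :=
  ∃ t : ℤ, IsCoprime t n ∧ ∃ γ : GaussianInt,
    (t : ℂ) * (α - β) = (n : ℂ) * GaussianInt.toComplex γ

/-!
Write `π = c + d i` and `ω = x + 2 π`. Everything rests on the rational case of quartic reciprocity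
in `ℤ[i]`, which compares `(n / α)₄` with `(α / n)₄` for odd `n ∈ ℤ` and `α ≡ 1 (mod 2)`. Both
symbols being multiplicative, it suffices to take `α` of prime norm `p` and `n = ℓ` prime, where it
follows by raising a quartic Gauss sum modulo `p` to the power `ℓ` and from the fact that the square
of the quartic Jacobi sum modulo `p` is `π²`.

Since `N(ω) = 2 x (x + 2 c) + q y²` and `ω² ≡ 4 (x + 2 c) π (mod y)`, reciprocity expresses
`(ω / q)₄` through `(x / π)₄`, `(y / π)₄` and a power of `i`; the coprimality of `d` and `x + 2 c`
makes the remaining symbols nonzero. When `c` and `x + 2 d` are coprime instead, the same argument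
applies to `-i π`, whose real and imaginary parts are `d` and `-c`.

On the other hand `ω^q ≡ conj ω` and `x conj ω ≡ 2 (conj π) ω (mod q)`, so the hypothesis on
`(2 (c - d i) / x)^((q + 1) / 4)` says that `(ω / q)₄ = i^m`. Finally, reduction modulo `π` sends
`i` to `d / c`, turns the quartic symbol into a `⌊p / 4⌋`-th power, and `-q = (x / y)²` there.
-/

open UniqueFactorizationMonoid

namespace QuarticReciprocity

local notation "ℤ[i]" => GaussianInt

/-- The imaginary unit of `ℤ[i]`. -/
def imagUnit : ℤ[i] := ⟨0, 1⟩

theorem imagUnit_sq : imagUnit ^ 2 = -1 := by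
  rw [sq]; rfl

theorem imagUnit_pow_four : imagUnit ^ 4 = 1 := by
  linear_combination (imagUnit ^ 2 - 1) * imagUnit_sq

theorem star_imagUnit : star imagUnit = -imagUnit := rfl

/-- The integral power `i ^ n` of the imaginary unit, as an element of `ℤ[i]`. -/
def imagPow (n : ℤ) : ℤ[i] :=
  (Units.ofPowEqOne imagUnit 4 imagUnit_pow_four four_ne_zero ^ n : ℤ[i]ˣ)

theorem imagPow_zero : imagPow 0 = 1 := rfl

theorem imagPow_add (m n : ℤ) : imagPow (m + n) = imagPow m * imagPow n := by
  rw [imagPow, zpow_add, Units.val_mul, imagPow, imagPow]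

theorem imagPow_mul_natCast (m : ℤ) (n : ℕ) : imagPow (m * n) = imagPow m ^ n := by
  rw [imagPow, zpow_mul, zpow_natCast, Units.val_pow_eq_pow_val, imagPow]

theorem imagPow_natCast (n : ℕ) : imagPow n = imagUnit ^ n := by
  rw [imagPow, zpow_natCast, Units.val_pow_eq_pow_val, Units.val_ofPowEqOne]

theorem imagPow_one : imagPow 1 = imagUnit := by
  simpa using imagPow_natCast 1

theorem imagPow_two : imagPow 2 = -1 :=
  (imagPow_natCast 2).trans imagUnit_sq

theorem imagPow_pow_four (n : ℤ) : imagPow n ^ 4 = 1 := by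
  rw [← imagPow_mul_natCast, mul_comm, imagPow, zpow_mul, zpow_natCast, Units.pow_ofPowEqOne,
    one_zpow, Units.val_one]

theorem imagPow_ne_zero (n : ℤ) : imagPow n ≠ 0 :=
  Units.ne_zero _

theorem imagPow_congr {m n : ℤ} (h : m ≡ n [ZMOD 4]) : imagPow m = imagPow n := by
  obtain ⟨k, hk⟩ := h.dvd
  rw [show n = m + k * (4 : ℕ) by push_cast; linarith, imagPow_add, imagPow_mul_natCast,
    imagPow_pow_four, mul_one]

theorem map_imagPow {F : Type*} [Field F] (θ : ℤ[i] →+* F) (n : ℤ) :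
    θ (imagPow n) = θ imagUnit ^ n := by
  rw [imagPow, ← MonoidHom.coe_coe, ← Units.coe_map, map_zpow, Units.val_zpow_eq_zpow_val]
  rfl

theorem eq_re_add_im_mul_imagUnit (α : ℤ[i]) : α = (α.re : ℤ[i]) + (α.im : ℤ[i]) * imagUnit := by
  ext <;> simp [imagUnit]

theorem norm_eq_sq_add_sq (α : ℤ[i]) : α.norm = α.re ^ 2 + α.im ^ 2 := by
  rw [Zsqrtd.norm_def]; ring

theorem natCast_natAbs_norm_div_four (α : ℤ[i]) : ((α.norm.natAbs / 4 : ℕ) : ℤ) = α.norm / 4 := by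
  rw [Int.natCast_ediv, GaussianInt.abs_natCast_norm, Nat.cast_ofNat]

theorem star_dvd_star {α β : ℤ[i]} (h : α ∣ β) : star α ∣ star β := by
  obtain ⟨γ, rfl⟩ := h
  exact ⟨star γ, by rw [star_mul, mul_comm]⟩

theorem pow_four_eq_one_iff {u : ℤ[i]} :
    u ^ 4 = 1 ↔ u = 1 ∨ u = -1 ∨ u = imagUnit ∨ u = -imagUnit := by
  have h : u ^ 4 - 1 = (u - 1) * ((u + 1) * ((u - imagUnit) * (u + imagUnit))) := by
    linear_combination (u ^ 2 - 1) * imagUnit_sq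
  rw [← sub_eq_zero, h]
  simp only [mul_eq_zero, sub_eq_zero, add_eq_zero_iff_eq_neg]

theorem isUnit_iff_pow_four_eq_one {u : ℤ[i]} : IsUnit u ↔ u ^ 4 = 1 := by
  refine ⟨fun hu => ?_, fun hu => IsUnit.of_pow_eq_one hu (by norm_num)⟩
  have h : u.re ^ 2 + u.im ^ 2 = 1 := by
    rw [← norm_eq_sq_add_sq, Zsqrtd.norm_eq_one_iff' (by norm_num)]
    exact hu
  have h1 : u.re ≤ 1 := by nlinarith
  have h2 : -1 ≤ u.re := by nlinarith
  have h3 : u.im ≤ 1 := by nlinarith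
  have h4 : -1 ≤ u.im := by nlinarith
  obtain ⟨a, b⟩ := u
  simp only at *
  interval_cases a <;> interval_cases b <;> first | rfl | simp at h

theorem mul_star_of_pow_four_eq_one {u : ℤ[i]} (hu : u ^ 4 = 1) : u * star u = 1 := by
  rw [← Zsqrtd.norm_eq_mul_conj,
    (Zsqrtd.norm_eq_one_iff' (by norm_num) u).2 (isUnit_iff_pow_four_eq_one.2 hu), Int.cast_one]

-- `Odd` in `ℤ[i]` means congruent to `1` modulo `2`, not merely prime to `1 + i`.
theorem odd_iff {α : ℤ[i]} : Odd α ↔ Odd α.re ∧ Even α.im := by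
  constructor
  · rintro ⟨β, rfl⟩
    simp
  · rintro ⟨⟨a, ha⟩, ⟨b, hb⟩⟩
    exact ⟨⟨a, b⟩, by ext <;> simp <;> omega⟩

theorem odd_intCast_iff {n : ℤ} : Odd (n : ℤ[i]) ↔ Odd n := by
  simp [odd_iff]

theorem isCoprime_two_of_odd {α : ℤ[i]} (h : Odd α) : IsCoprime α 2 := by
  obtain ⟨β, rfl⟩ := h
  exact ⟨1, -β, by ring⟩

theorem isCoprime_two_iff {α : ℤ[i]} : IsCoprime α 2 ↔ Odd α.norm := by
  constructor
  · rintro ⟨β, γ, h⟩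
    have h1 : β.norm * α.norm = (1 - γ * 2).norm := by
      rw [← Zsqrtd.norm_mul]
      congr 1
      linear_combination h
    have h2 : (1 - γ * 2).norm = 2 * (-2 * γ.re + 2 * γ.re ^ 2 + 2 * γ.im ^ 2) + 1 := by
      simp only [norm_eq_sq_add_sq, Zsqrtd.re_sub, Zsqrtd.im_sub, Zsqrtd.re_one, Zsqrtd.im_one,
        Zsqrtd.re_mul, Zsqrtd.im_mul, Zsqrtd.re_ofNat, Zsqrtd.im_ofNat]
      ring
    exact Int.Odd.of_mul_right ⟨_, h1.trans h2⟩
  · rintro ⟨k, hk⟩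
    have h1 := Zsqrtd.norm_eq_mul_conj α
    rw [hk] at h1
    exact ⟨star α, -(k : ℤ[i]), by push_cast at h1; linear_combination -h1⟩

theorem eq_one_or_neg_one_of_isUnit_of_odd {u : ℤ[i]} (hu : IsUnit u) (h : Odd u) :
    u = 1 ∨ u = -1 := by
  rcases pow_four_eq_one_iff.1 (isUnit_iff_pow_four_eq_one.1 hu) with rfl | rfl | rfl | rfl
  · exact Or.inl rfl
  · exact Or.inr rfl
  · exact absurd (odd_iff.1 h).1 (by decide)
  · exact absurd (odd_iff.1 h).1 (by decide)

theorem exists_associated_odd {α : ℤ[i]} (h : IsCoprime α 2) : ∃ β, Associated α β ∧ Odd β := by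
  rw [isCoprime_two_iff, norm_eq_sq_add_sq] at h
  rcases Int.even_or_odd α.re with hre | hre
  · have hi : IsUnit imagUnit := isUnit_iff_pow_four_eq_one.2 imagUnit_pow_four
    refine ⟨α * imagUnit, ⟨hi.unit, rfl⟩, odd_iff.2 ?_⟩
    simpa [imagUnit, Int.odd_add', Int.odd_pow, Int.even_pow, hre] using h
  · refine ⟨α, Associated.refl α, odd_iff.2 ⟨hre, ?_⟩⟩
    simpa [Int.odd_add, Int.odd_pow, Int.even_pow, hre] using h

/-- A Gaussian prime that is not associated to `1 + i`. -/
structure PrimeNotDvdTwo (π : ℤ[i]) : Prop where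
  prime : Prime π
  not_dvd_two : ¬ π ∣ 2

namespace PrimeNotDvdTwo

theorem isCoprime_two {π : ℤ[i]} (hπ : PrimeNotDvdTwo π) : IsCoprime π 2 :=
  hπ.prime.irreducible.coprime_iff_not_dvd.2 hπ.not_dvd_two

theorem of_odd {π : ℤ[i]} (hπ : Prime π) (h : Odd π) : PrimeNotDvdTwo π :=
  ⟨hπ, fun hd => hπ.not_isUnit ((isCoprime_two_of_odd h).isUnit_of_dvd' dvd_rfl hd)⟩

theorem of_dvd {π ω : ℤ[i]} (hπ : Prime π) (hω : IsCoprime ω 2) (h : π ∣ ω) : PrimeNotDvdTwo π :=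
  ⟨hπ, fun hd => hπ.not_isUnit (hω.isUnit_of_dvd' h hd)⟩

theorem associated {π π' : ℤ[i]} (hπ : PrimeNotDvdTwo π) (h : Associated π π') :
    PrimeNotDvdTwo π' :=
  ⟨h.prime hπ.prime, fun hd => hπ.not_dvd_two (h.dvd.trans hd)⟩

theorem conj {π : ℤ[i]} (hπ : PrimeNotDvdTwo π) : PrimeNotDvdTwo (star π) :=
  ⟨(MulEquiv.prime_iff (starMulAut : MulAut ℤ[i])).2 hπ.prime,
    fun h => hπ.not_dvd_two (by simpa using star_dvd_star h)⟩

end PrimeNotDvdTwo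

theorem exists_natPrime_dvd {π : ℤ[i]} (hπ : Prime π) :
    ∃ ℓ : ℕ, ℓ.Prime ∧ π ∣ ℓ := by
  have hn : π.norm.natAbs ≠ 0 := by simpa [GaussianInt.norm_eq_zero] using hπ.ne_zero
  have h : π ∣ ((π.norm.natAbs.primeFactorsList.map (Nat.cast : ℕ → ℤ[i])).prod) := by
    rw [← Nat.cast_list_prod, Nat.prod_primeFactorsList hn, GaussianInt.natCast_natAbs_norm,
      Zsqrtd.norm_eq_mul_conj]
    exact dvd_mul_right _ _
  obtain ⟨_, hmem, hdvd⟩ := hπ.dvd_prod_iff.1 h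
  obtain ⟨ℓ, hℓ, rfl⟩ := List.mem_map.1 hmem
  exact ⟨ℓ, Nat.prime_of_mem_primeFactorsList hℓ, hdvd⟩

theorem sq_add_sq_mod_four_of_odd {a b : ℤ} (h : Odd (a ^ 2 + b ^ 2)) :
    (a ^ 2 + b ^ 2) % 4 = 1 := by
  rcases Int.even_or_odd' a with ⟨a, rfl | rfl⟩ <;>
    rcases Int.even_or_odd' b with ⟨b, rfl | rfl⟩ <;>
    rw [Int.odd_iff] at h <;> ring_nf at h ⊢ <;> omega

theorem norm_mod_four_eq_one {α : ℤ[i]} (h : IsCoprime α 2) : α.norm % 4 = 1 := by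
  rw [isCoprime_two_iff] at h
  rw [norm_eq_sq_add_sq] at h ⊢
  exact sq_add_sq_mod_four_of_odd h

namespace PrimeNotDvdTwo

theorem inert_or_split {π : ℤ[i]} (hπ : PrimeNotDvdTwo π) :
    ∃ ℓ : ℕ, ℓ.Prime ∧
      ((ℓ % 4 = 3 ∧ Associated π ℓ) ∨ (ℓ % 4 = 1 ∧ π.norm = ℓ)) := by
  obtain ⟨ℓ, hℓ, τ, hτ⟩ := exists_natPrime_dvd hπ.prime
  have := Fact.mk hℓ
  refine ⟨ℓ, hℓ, ?_⟩
  have hN : π.norm.natAbs * τ.norm.natAbs = ℓ ^ 2 := by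
    rw [← Int.natAbs_mul, ← Zsqrtd.norm_mul, ← hτ, Zsqrtd.norm_natCast, ← Nat.cast_mul,
      Int.natAbs_natCast, sq]
  obtain ⟨k, hk, hk'⟩ := (Nat.dvd_prime_pow hℓ).1 (Dvd.intro _ hN)
  interval_cases k
  · exact absurd (Zsqrtd.norm_eq_one_iff.1 (by simpa using hk')) hπ.prime.not_isUnit
  · have hπℓ : π.norm = ℓ := by rw [← GaussianInt.abs_natCast_norm, hk', pow_one]
    have := norm_mod_four_eq_one hπ.isCoprime_two
    exact Or.inr ⟨by omega, hπℓ⟩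
  · have hu : IsUnit τ := by
      rw [← Zsqrtd.norm_eq_one_iff]
      exact Nat.eq_of_mul_eq_mul_left (pow_pos hℓ.pos 2) (by rw [← hk', hN, hk', mul_one])
    have hass : Associated π ℓ := ⟨hu.unit, hτ.symm⟩
    exact Or.inl ⟨GaussianInt.mod_four_eq_three_of_nat_prime_of_prime ℓ (hass.prime hπ.prime), hass⟩

end PrimeNotDvdTwo

theorem dvd_norm (α : ℤ[i]) : α ∣ (α.norm : ℤ[i]) :=
  ⟨star α, Zsqrtd.norm_eq_mul_conj α⟩

theorem natPrime_dvd_pow_sub {ℓ : ℕ} (hℓ : ℓ.Prime) (α : ℤ[i]) :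
    (ℓ : ℤ[i]) ∣ α ^ ℓ - (α.re + α.im * imagUnit ^ ℓ) := by
  have fermat (a : ℤ) : (ℓ : ℤ[i]) ∣ (a : ℤ[i]) ^ ℓ - a := by
    exact_mod_cast Int.cast_dvd_cast (α := ℤ[i]) _ _ (Int.ModEq.pow_prime_eq_self hℓ a).symm.dvd
  obtain ⟨r, hr⟩ := exists_add_pow_prime_eq hℓ (α.re : ℤ[i]) (α.im * imagUnit)
  obtain ⟨s, hs⟩ := fermat α.re
  obtain ⟨t, ht⟩ := fermat α.im
  refine ⟨s + imagUnit ^ ℓ * t + α.re * (α.im * imagUnit) * r, ?_⟩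
  nth_rw 1 [eq_re_add_im_mul_imagUnit α]
  rw [hr, mul_pow]
  linear_combination hs + imagUnit ^ ℓ * ht

theorem natPrime_dvd_pow_sub_self {ℓ : ℕ} (hℓ : ℓ.Prime) (h : ℓ % 4 = 1) (α : ℤ[i]) :
    (ℓ : ℤ[i]) ∣ α ^ ℓ - α := by
  have hi : imagUnit ^ ℓ = imagUnit := by
    rw [← imagPow_natCast, imagPow_congr (n := 1) (by rw [Int.ModEq]; omega), imagPow_one]
  have := natPrime_dvd_pow_sub hℓ α
  rwa [hi, ← eq_re_add_im_mul_imagUnit] at this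

theorem natPrime_dvd_pow_sub_star {ℓ : ℕ} (hℓ : ℓ.Prime) (h : ℓ % 4 = 3) (α : ℤ[i]) :
    (ℓ : ℤ[i]) ∣ α ^ ℓ - star α := by
  have hi : imagUnit ^ ℓ = -imagUnit := by
    rw [← imagPow_natCast, imagPow_congr (n := 2 + 1) (by rw [Int.ModEq]; omega), imagPow_add,
      imagPow_two, imagPow_one, neg_one_mul]
  have hα : star α = α.re + α.im * imagUnit ^ ℓ := by
    rw [hi]
    ext <;> simp [imagUnit]
  rw [hα]
  exact natPrime_dvd_pow_sub hℓ α

theorem natPrime_dvd_pow_sq_sub_self {ℓ : ℕ} (hℓ : ℓ.Prime) (h : ℓ % 4 = 3) (α : ℤ[i]) :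
    (ℓ : ℤ[i]) ∣ α ^ (ℓ ^ 2) - α := by
  have h1 := natPrime_dvd_pow_sub_star hℓ h (star α)
  have h2 := (natPrime_dvd_pow_sub_star hℓ h α).trans (sub_dvd_pow_sub_pow _ _ ℓ)
  rw [star_star] at h1
  rw [sq, pow_mul]
  simpa using dvd_add h2 h1

theorem PrimeNotDvdTwo.dvd_pow_norm_sub_self {π : ℤ[i]} (hπ : PrimeNotDvdTwo π) (α : ℤ[i]) :
    π ∣ α ^ π.norm.natAbs - α := by
  obtain ⟨ℓ, hℓ, ⟨h, hass⟩ | ⟨h, hN⟩⟩ := hπ.inert_or_split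
  · rw [Zsqrtd.norm_eq_of_associated (by norm_num) hass, Zsqrtd.norm_natCast, Int.natAbs_mul,
      Int.natAbs_natCast, ← sq]
    exact hass.dvd.trans (natPrime_dvd_pow_sq_sub_self hℓ h α)
  · have hd : π ∣ (ℓ : ℤ[i]) := by simpa [hN] using dvd_norm π
    rw [hN, Int.natAbs_natCast]
    exact hd.trans (natPrime_dvd_pow_sub_self hℓ h α)

theorem pow_five_eq_self_iff {u : ℤ[i]} : u ^ 5 = u ↔ u = 0 ∨ u ^ 4 = 1 := by
  rw [← sub_eq_zero, show u ^ 5 - u = u * (u ^ 4 - 1) by ring, mul_eq_zero, sub_eq_zero]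

section PrimeSymbol

variable {π : ℤ[i]}

namespace PrimeNotDvdTwo

theorem eq_of_pow_five_eq_self (hπ : PrimeNotDvdTwo π) {u v : ℤ[i]} (hu : u ^ 5 = u)
    (hv : v ^ 5 = v) (h : π ∣ u - v) : u = v := by
  by_contra hne
  have hquot : u ^ 4 + u ^ 3 * v + u ^ 2 * v ^ 2 + u * v ^ 3 + v ^ 4 - 1 = 0 := by
    apply mul_left_cancel₀ (sub_ne_zero.mpr hne)
    linear_combination hu - hv
  have h5 : π ∣ 5 * v ^ 4 - 1 := by
    convert h.mul_right (-(u ^ 3 + 2 * u ^ 2 * v + 3 * u * v ^ 2 + 4 * v ^ 3)) using 1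
    linear_combination hquot
  rcases pow_five_eq_self_iff.1 hv with rfl | hv
  · exact hπ.prime.not_isUnit (isUnit_of_dvd_one (by simpa using h5))
  · rw [hv, show (5 * 1 - 1 : ℤ[i]) = 2 * 2 by norm_num] at h5
    exact (hπ.prime.dvd_or_dvd h5).elim hπ.not_dvd_two hπ.not_dvd_two

theorem natAbs_norm_eq (hπ : PrimeNotDvdTwo π) :
    π.norm.natAbs = π.norm.natAbs / 4 * 4 + 1 := by
  have := norm_mod_four_eq_one hπ.isCoprime_two
  have := GaussianInt.abs_natCast_norm π
  omega

theorem natAbs_norm_div_four_ne_zero (hπ : PrimeNotDvdTwo π) : π.norm.natAbs / 4 ≠ 0 := by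
  intro h
  have h1 := hπ.natAbs_norm_eq
  rw [h, zero_mul, zero_add] at h1
  exact hπ.prime.not_isUnit (Zsqrtd.norm_eq_one_iff.1 h1)

theorem exists_dvd_pow_sub (hπ : PrimeNotDvdTwo π) (α : ℤ[i]) :
    ∃ u : ℤ[i], u ^ 5 = u ∧ π ∣ α ^ (π.norm.natAbs / 4) - u := by
  have hk := hπ.natAbs_norm_div_four_ne_zero
  have hfermat := hπ.dvd_pow_norm_sub_self α
  rw [hπ.natAbs_norm_eq, pow_succ, pow_mul] at hfermat
  set k := π.norm.natAbs / 4
  have hfactor : (α ^ k) ^ 4 * α - α =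
      α * ((α ^ k - 1) * ((α ^ k - -1) * ((α ^ k - imagUnit) * (α ^ k - -imagUnit)))) := by
    linear_combination (α * ((α ^ k) ^ 2 - 1)) * imagUnit_sq
  rw [hfactor] at hfermat
  rcases hπ.prime.dvd_or_dvd hfermat with h | h
  · exact ⟨0, by norm_num, by simpa using dvd_pow h hk⟩
  have root {u : ℤ[i]} (hu : u ^ 4 = 1) (h : π ∣ α ^ k - u) :
      ∃ u : ℤ[i], u ^ 5 = u ∧ π ∣ α ^ k - u := ⟨u, pow_five_eq_self_iff.2 (Or.inr hu), h⟩
  rcases hπ.prime.dvd_or_dvd h with h | h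
  · exact root (one_pow 4) h
  rcases hπ.prime.dvd_or_dvd h with h | h
  · exact root (by norm_num) h
  rcases hπ.prime.dvd_or_dvd h with h | h
  · exact root imagUnit_pow_four h
  · exact root (by rw [Even.neg_pow (by decide), imagUnit_pow_four]) h

theorem eq_of_dvd_pow_sub (hπ : PrimeNotDvdTwo π) {α u v : ℤ[i]} (hu : u ^ 5 = u) (hv : v ^ 5 = v)
    (hαu : π ∣ α ^ (π.norm.natAbs / 4) - u) (hαv : π ∣ α ^ (π.norm.natAbs / 4) - v) : u = v :=
  hπ.eq_of_pow_five_eq_self hu hv (by simpa using dvd_sub hαv hαu)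

end PrimeNotDvdTwo

open Classical in
/-- The quartic residue symbol modulo a Gaussian prime `π` not above `2`, as a function of the
numerator: it sends `α` to the `u ∈ {0, ±1, ±i}` with `α ^ ((N π - 1) / 4) ≡ u (mod π)`. For all
other `π` it is the constant `1`. -/
noncomputable def primeQuarticSymbol (π : ℤ[i]) : ℤ[i] →* ℤ[i] :=
  if hπ : PrimeNotDvdTwo π then
    { toFun := fun α => (hπ.exists_dvd_pow_sub α).choose
      map_one' := hπ.eq_of_dvd_pow_sub (hπ.exists_dvd_pow_sub 1).choose_spec.1 (one_pow 5)
        (hπ.exists_dvd_pow_sub 1).choose_spec.2 (by simp)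
      map_mul' := fun α β => by
        have hα := (hπ.exists_dvd_pow_sub α).choose_spec
        have hβ := (hπ.exists_dvd_pow_sub β).choose_spec
        have hαβ := (hπ.exists_dvd_pow_sub (α * β)).choose_spec
        refine hπ.eq_of_dvd_pow_sub hαβ.1 (by rw [mul_pow, hα.1, hβ.1]) hαβ.2 ?_
        rw [mul_pow]
        exact dvd_mul_sub_mul hα.2 hβ.2 }
  else 1

namespace PrimeNotDvdTwo

theorem symbol_pow_five_and_dvd (hπ : PrimeNotDvdTwo π) (α : ℤ[i]) :
    primeQuarticSymbol π α ^ 5 = primeQuarticSymbol π α ∧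
      π ∣ α ^ (π.norm.natAbs / 4) - primeQuarticSymbol π α := by
  rw [primeQuarticSymbol, dif_pos hπ]
  exact (hπ.exists_dvd_pow_sub α).choose_spec

theorem symbol_eq (hπ : PrimeNotDvdTwo π) {α u : ℤ[i]} (hu : u ^ 5 = u)
    (h : π ∣ α ^ (π.norm.natAbs / 4) - u) : primeQuarticSymbol π α = u :=
  hπ.eq_of_dvd_pow_sub (hπ.symbol_pow_five_and_dvd α).1 hu (hπ.symbol_pow_five_and_dvd α).2 h

theorem symbol_star (hπ : PrimeNotDvdTwo π) (α : ℤ[i]) :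
    primeQuarticSymbol (star π) (star α) = star (primeQuarticSymbol π α) := by
  obtain ⟨h5, hdvd⟩ := hπ.symbol_pow_five_and_dvd α
  refine hπ.conj.symbol_eq (by rw [← star_pow, h5]) ?_
  rw [Zsqrtd.norm_conj]
  simpa using star_dvd_star hdvd

theorem symbol_eq_zero_iff (hπ : PrimeNotDvdTwo π) {α : ℤ[i]} :
    primeQuarticSymbol π α = 0 ↔ π ∣ α := by
  constructor
  · intro h
    have hdvd := (hπ.symbol_pow_five_and_dvd α).2
    rw [h, sub_zero] at hdvd
    exact hπ.prime.dvd_of_dvd_pow hdvd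
  · intro h
    refine hπ.symbol_eq (zero_pow (by norm_num)) ?_
    rw [sub_zero]
    exact dvd_pow h hπ.natAbs_norm_div_four_ne_zero

end PrimeNotDvdTwo

theorem primeQuarticSymbol_pow_five (π α : ℤ[i]) :
    primeQuarticSymbol π α ^ 5 = primeQuarticSymbol π α := by
  by_cases hπ : PrimeNotDvdTwo π
  · exact (hπ.symbol_pow_five_and_dvd α).1
  · rw [primeQuarticSymbol, dif_neg hπ, MonoidHom.one_apply, one_pow]

theorem primeQuarticSymbol_congr {α β : ℤ[i]} (h : π ∣ α - β) :
    primeQuarticSymbol π α = primeQuarticSymbol π β := by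
  by_cases hπ : PrimeNotDvdTwo π
  · obtain ⟨h5, hdvd⟩ := hπ.symbol_pow_five_and_dvd β
    refine hπ.symbol_eq h5 ?_
    simpa using dvd_add (h.trans (sub_dvd_pow_sub_pow α β (π.norm.natAbs / 4))) hdvd
  · rw [primeQuarticSymbol, dif_neg hπ, MonoidHom.one_apply, MonoidHom.one_apply]

theorem primeQuarticSymbol_associated {π' : ℤ[i]} (h : Associated π π') :
    primeQuarticSymbol π = primeQuarticSymbol π' := by
  by_cases hπ : PrimeNotDvdTwo π
  · ext1 α
    obtain ⟨h5, hdvd⟩ := hπ.symbol_pow_five_and_dvd α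
    refine ((hπ.associated h).symbol_eq h5 ?_).symm
    rwa [← Zsqrtd.norm_eq_of_associated (by norm_num) h, ← h.dvd_iff_dvd_left]
  · rw [primeQuarticSymbol, dif_neg hπ, primeQuarticSymbol,
      dif_neg fun hπ' => hπ (hπ'.associated h.symm)]

end PrimeSymbol

/-- The quartic residue symbol of Jacobi type on `ℤ[i]`: `quarticSymbol ω α` is `(α / ω)₄`, the
product of the symbols of `α` modulo the prime factors of `ω`, where primes above `2` contribute
`1`. -/
noncomputable def quarticSymbol (ω : ℤ[i]) : ℤ[i] →* ℤ[i] :=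
  ((factors ω).map primeQuarticSymbol).prod

theorem quarticSymbol_apply (ω α : ℤ[i]) :
    quarticSymbol ω α = ((factors ω).map fun π => primeQuarticSymbol π α).prod := by
  rw [quarticSymbol, ← MonoidHom.eval_apply_apply, map_multiset_prod, Multiset.map_map]
  rfl

theorem prod_map_primeQuarticSymbol_eq_of_rel {s t : Multiset ℤ[i]}
    (h : Multiset.Rel Associated s t) :
    (s.map primeQuarticSymbol).prod = (t.map primeQuarticSymbol).prod := by
  induction h with
  | zero => rfl
  | cons hab _ ih =>
    rw [Multiset.map_cons, Multiset.prod_cons, Multiset.map_cons, Multiset.prod_cons, ih,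
      primeQuarticSymbol_associated hab]

theorem quarticSymbol_of_prime {π : ℤ[i]} (hπ : Prime π) :
    quarticSymbol π = primeQuarticSymbol π := by
  obtain ⟨τ, hτ, hfactors⟩ := prime_factors_irreducible hπ.irreducible
    ⟨fun _ h => prime_of_factor _ h, factors_prod hπ.ne_zero⟩
  rw [quarticSymbol, hfactors, Multiset.map_singleton, Multiset.prod_singleton,
    primeQuarticSymbol_associated hτ]

theorem quarticSymbol_associated {ω ω' : ℤ[i]} (h : Associated ω ω') :
    quarticSymbol ω = quarticSymbol ω' :=
  prod_map_primeQuarticSymbol_eq_of_rel (factors_rel_of_associated h)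

theorem quarticSymbol_neg (ω : ℤ[i]) : quarticSymbol (-ω) = quarticSymbol ω :=
  (quarticSymbol_associated (Associated.refl ω).neg_right).symm

theorem quarticSymbol_mul {ω ω' : ℤ[i]} (hω : ω ≠ 0) (hω' : ω' ≠ 0) :
    quarticSymbol (ω * ω') = quarticSymbol ω * quarticSymbol ω' := by
  rw [quarticSymbol, quarticSymbol, quarticSymbol, ← Multiset.prod_add, ← Multiset.map_add]
  exact prod_map_primeQuarticSymbol_eq_of_rel (factors_mul hω hω')

theorem quarticSymbol_of_isUnit {ω : ℤ[i]} (hω : IsUnit ω) : quarticSymbol ω = 1 := by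
  rw [quarticSymbol, factors_of_isUnit hω, Multiset.map_zero, Multiset.prod_zero]

theorem quarticSymbol_congr {ω α β : ℤ[i]} (h : ω ∣ α - β) :
    quarticSymbol ω α = quarticSymbol ω β := by
  rw [quarticSymbol_apply, quarticSymbol_apply, Multiset.map_congr rfl fun π hπ =>
    primeQuarticSymbol_congr ((dvd_of_mem_factors hπ).trans h)]

theorem quarticSymbol_pow_five (ω α : ℤ[i]) :
    quarticSymbol ω α ^ 5 = quarticSymbol ω α := by
  simp_rw [quarticSymbol_apply, ← Multiset.prod_map_pow, primeQuarticSymbol_pow_five]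

theorem ne_zero_of_isCoprime_two {ω : ℤ[i]} (hω : IsCoprime ω 2) : ω ≠ 0 := by
  rintro rfl
  simp [isCoprime_two_iff] at hω

theorem quarticSymbol_eq_zero_iff {ω α : ℤ[i]} (hω : IsCoprime ω 2) :
    quarticSymbol ω α = 0 ↔ ¬ IsCoprime ω α := by
  have hω0 := ne_zero_of_isCoprime_two hω
  rw [quarticSymbol_apply, Multiset.prod_eq_zero_iff, Multiset.mem_map]
  constructor
  · rintro ⟨π, hπ, h0⟩ hcop
    have hprime := prime_of_factor π hπ
    rw [(PrimeNotDvdTwo.of_dvd hprime hω (dvd_of_mem_factors hπ)).symbol_eq_zero_iff] at h0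
    exact hprime.not_isUnit (hcop.isUnit_of_dvd' (dvd_of_mem_factors hπ) h0)
  · intro hcop
    obtain ⟨τ, hτ, hτω, hτα⟩ : ∃ τ, Prime τ ∧ τ ∣ ω ∧ τ ∣ α := by
      by_contra! h
      exact hcop (isCoprime_of_prime_dvd (fun h0 => hω0 h0.1) h)
    obtain ⟨π, hπ, hass⟩ := exists_mem_factors_of_dvd hω0 hτ.irreducible hτω
    refine ⟨π, hπ, ?_⟩
    have hπ2 := PrimeNotDvdTwo.of_dvd (prime_of_factor π hπ) hω (dvd_of_mem_factors hπ)
    rw [hπ2.symbol_eq_zero_iff]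
    exact hass.symm.dvd.trans hτα

theorem quarticSymbol_pow_four {ω α : ℤ[i]} (hω : IsCoprime ω 2) (h : IsCoprime ω α) :
    quarticSymbol ω α ^ 4 = 1 :=
  (pow_five_eq_self_iff.1 (quarticSymbol_pow_five ω α)).resolve_left fun h0 =>
    (quarticSymbol_eq_zero_iff hω).1 h0 h

theorem odd_of_odd_mul {α β : ℤ[i]} (hα : Odd α) (h : Odd (α * β)) : Odd β := by
  obtain ⟨γ, rfl⟩ := hα
  obtain ⟨δ, hδ⟩ := h
  exact ⟨δ - γ * β, by linear_combination hδ⟩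

theorem odd_induction {P : ℤ[i] → Prop} (intCast : ∀ n : ℤ, Odd n → P n)
    (split : ∀ (π : ℤ[i]) (ℓ : ℕ), ℓ.Prime → ℓ % 4 = 1 → π.norm = ℓ → Odd π → P π)
    (mul : ∀ α β, Odd α → Odd β → P α → P β → P (α * β)) {α : ℤ[i]} (hα : Odd α) : P α := by
  have unit {u : ℤ[i]} (hu : IsUnit u) (h : Odd u) : P u := by
    rcases eq_one_or_neg_one_of_isUnit_of_odd hu h with rfl | rfl
    · simpa using intCast 1 (by decide)
    · simpa using intCast (-1) (by decide)
  have transfer {β γ : ℤ[i]} (h : Associated β γ) (hβ : Odd β) (hγ : Odd γ) (hPβ : P β) : P γ := by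
    obtain ⟨u, rfl⟩ := h
    have hu := odd_of_odd_mul hβ hγ
    exact mul β u hβ hu hPβ (unit u.isUnit hu)
  suffices h : ∀ α : ℤ[i], IsCoprime α 2 → ∃ β, Associated α β ∧ Odd β ∧ P β by
    obtain ⟨β, hαβ, hβ, hPβ⟩ := h α (isCoprime_two_of_odd hα)
    exact transfer hαβ.symm hβ hα hPβ
  intro α
  induction α using UniqueFactorizationMonoid.induction_on_prime with
  | h₁ => exact fun h => absurd rfl (ne_zero_of_isCoprime_two h)
  | h₂ u hu => exact fun _ => ⟨1, associated_one_iff_isUnit.2 hu, odd_one, unit isUnit_one odd_one⟩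
  | h₃ α π _ hπ ih =>
    intro h
    obtain ⟨β, hαβ, hβ, hPβ⟩ := ih h.of_mul_left_right
    obtain ⟨π', hππ', hπ', hPπ'⟩ : ∃ π', Associated π π' ∧ Odd π' ∧ P π' := by
      have hπ2 := PrimeNotDvdTwo.of_dvd hπ h (dvd_mul_right π α)
      obtain ⟨ℓ, hℓ, ⟨h4, hass⟩ | ⟨h4, hN⟩⟩ := hπ2.inert_or_split
      · have hodd : Odd (ℓ : ℤ) := Int.odd_iff.2 (by omega)
        exact ⟨ℓ, hass, by exact_mod_cast odd_intCast_iff.2 hodd, by exact_mod_cast intCast ℓ hodd⟩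
      · obtain ⟨π', hass, hodd⟩ := exists_associated_odd hπ2.isCoprime_two
        rw [Zsqrtd.norm_eq_of_associated (by norm_num) hass] at hN
        exact ⟨π', hass, hodd, split π' ℓ hℓ h4 hN hodd⟩
    exact ⟨π' * β, hππ'.mul_mul hαβ, hπ'.mul hβ, mul π' β hπ' hβ hPπ' hPβ⟩

theorem isCoprime_intCast_iff {a b : ℤ} : IsCoprime (a : ℤ[i]) (b : ℤ[i]) ↔ IsCoprime a b := by
  refine ⟨fun ⟨α, β, h⟩ => ⟨α.re, β.re, ?_⟩, fun h => h.map (Int.castRingHom ℤ[i])⟩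
  simpa using congrArg Zsqrtd.re h

theorem prime_of_norm_eq_natPrime {π : ℤ[i]} {p : ℕ} (hp : p.Prime) (hN : π.norm = p) :
    Prime π := by
  rw [← irreducible_iff_prime]
  refine ⟨fun hu => ?_, fun α β hαβ => ?_⟩
  · rw [← Zsqrtd.norm_eq_one_iff, hN, Int.natAbs_natCast] at hu
    exact hp.one_lt.ne' hu
  · rw [← Zsqrtd.norm_eq_one_iff, ← Zsqrtd.norm_eq_one_iff]
    have hmul : α.norm.natAbs * β.norm.natAbs = p := by
      rw [← Int.natAbs_mul, ← Zsqrtd.norm_mul, ← hαβ, hN, Int.natAbs_natCast]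
    exact (Nat.prime_mul_iff.1 (hmul ▸ hp)).symm.imp And.right And.right

theorem PrimeNotDvdTwo.of_norm_eq {π : ℤ[i]} {p : ℕ} (hp : p.Prime) (hp4 : p % 4 = 1)
    (hN : π.norm = p) : PrimeNotDvdTwo π :=
  .of_dvd (prime_of_norm_eq_natPrime hp hN)
    (isCoprime_two_iff.2 (by rw [hN, Int.odd_iff]; omega)) dvd_rfl

theorem exists_norm_eq_natPrime {ℓ : ℕ} (hℓ : ℓ.Prime) (h : ℓ % 4 = 1) :
    ∃ π : ℤ[i], π.norm = ℓ := by
  have := Fact.mk hℓ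
  obtain ⟨a, b, hab⟩ := Nat.Prime.sq_add_sq (p := ℓ) (by omega)
  exact ⟨⟨a, b⟩, by rw [norm_eq_sq_add_sq, ← hab]; push_cast; rfl⟩

theorem natPrime_dvd_pow_sub_one {ℓ : ℕ} (hℓ : ℓ.Prime) {a : ℤ} (ha : IsCoprime (ℓ : ℤ) a) :
    (ℓ : ℤ[i]) ∣ (a : ℤ[i]) ^ (ℓ - 1) - 1 := by
  have h := (Int.ModEq.pow_card_sub_one_eq_one hℓ ha.symm).symm.dvd
  exact_mod_cast Int.cast_dvd_cast (α := ℤ[i]) _ _ h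

theorem natAbs_norm_natCast_div_four {ℓ : ℕ} (h : ℓ % 4 = 3) :
    (ℓ : ℤ[i]).norm.natAbs / 4 = (ℓ - 1) * ((ℓ + 1) / 4) := by
  rw [Zsqrtd.norm_natCast, Int.natAbs_mul, Int.natAbs_natCast]
  obtain ⟨k, rfl⟩ : ∃ k, ℓ = 4 * k + 3 := ⟨ℓ / 4, by omega⟩
  rw [show 4 * k + 3 + 1 = 4 * (k + 1) by ring, Nat.mul_div_cancel_left _ (by norm_num),
    show (4 * k + 3) * (4 * k + 3) = 1 + 4 * ((4 * k + 2) * (k + 1)) by ring,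
    Nat.add_mul_div_left _ _ (by norm_num)]
  simp

theorem quarticSymbol_natPrime_intCast {ℓ : ℕ} (hℓ : ℓ.Prime) (hodd : Odd ℓ) {a : ℤ}
    (h : IsCoprime (ℓ : ℤ) a) : quarticSymbol (ℓ : ℤ[i]) a = 1 := by
  have := Fact.mk hℓ
  rcases Nat.odd_mod_four_iff.1 (Nat.odd_iff.1 hodd) with h4 | h4
  · obtain ⟨π, hN⟩ := exists_norm_eq_natPrime hℓ h4
    have hπ := PrimeNotDvdTwo.of_norm_eq hℓ h4 hN
    have hℓπ : (ℓ : ℤ[i]) = π * star π := by rw [← Zsqrtd.norm_eq_mul_conj, hN, Int.cast_natCast]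
    have hcop : IsCoprime π (a : ℤ[i]) := by
      have := isCoprime_intCast_iff.2 h
      rw [Int.cast_natCast, hℓπ] at this
      exact this.of_mul_left_left
    have hstar := hπ.symbol_star a
    rw [star_intCast] at hstar
    rw [hℓπ, quarticSymbol_mul hπ.prime.ne_zero hπ.conj.prime.ne_zero, MonoidHom.mul_apply,
      quarticSymbol_of_prime hπ.conj.prime, hstar, ← quarticSymbol_of_prime hπ.prime]
    exact mul_star_of_pow_four_eq_one (quarticSymbol_pow_four hπ.isCoprime_two hcop)
  · have hprime := GaussianInt.prime_of_nat_prime_of_mod_four_eq_three ℓ h4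
    have hℓ2 := PrimeNotDvdTwo.of_odd hprime hodd.natCast
    rw [quarticSymbol_of_prime hprime]
    refine hℓ2.symbol_eq (one_pow 5) ?_
    rw [natAbs_norm_natCast_div_four h4, pow_mul]
    exact (natPrime_dvd_pow_sub_one hℓ h).trans
      (by simpa using sub_dvd_pow_sub_pow ((a : ℤ[i]) ^ (ℓ - 1)) 1 _)

theorem int_odd_induction {P : ℤ → Prop} (one : P 1) (neg : ∀ n, Odd n → P n → P (-n))
    (natPrime_mul : ∀ (ℓ : ℕ) (n : ℤ), ℓ.Prime → Odd ℓ → Odd n → P n → P (ℓ * n)) {n : ℤ}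
    (hn : Odd n) : P n := by
  have nat (k : ℕ) (hk : Odd k) : P k := by
    induction k using induction_on_primes with
    | zero => simp at hk
    | one => exact one
    | prime_mul ℓ k hℓ ih =>
      obtain ⟨hℓ2, hk2⟩ := Nat.odd_mul.1 hk
      rw [Nat.cast_mul]
      exact natPrime_mul ℓ k hℓ hℓ2 ((Int.odd_coe_nat k).2 hk2) (ih hk2)
  rcases Int.natAbs_eq n with h | h <;> rw [h]
  · exact nat _ (Int.natAbs_odd.2 hn)
  · exact neg _ ((Int.odd_coe_nat _).2 (Int.natAbs_odd.2 hn)) (nat _ (Int.natAbs_odd.2 hn))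

theorem quarticSymbol_intCast_intCast {n a : ℤ} (hn : Odd n) (h : IsCoprime n a) :
    quarticSymbol (n : ℤ[i]) a = 1 := by
  revert h
  refine int_odd_induction (P := fun n => IsCoprime n a → quarticSymbol (n : ℤ[i]) a = 1)
    (fun _ => ?_) (fun n _ ih h => ?_) (fun ℓ n hℓ hℓ2 hn2 ih h => ?_) hn
  · rw [Int.cast_one, quarticSymbol_of_isUnit isUnit_one, MonoidHom.one_apply]
  · rw [Int.cast_neg, quarticSymbol_neg, ih ((IsCoprime.neg_left_iff _ _).1 h)]
  · rw [Int.cast_mul, Int.cast_natCast, quarticSymbol_mul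
      (by exact_mod_cast hℓ.ne_zero)
      (ne_zero_of_isCoprime_two (isCoprime_two_of_odd (odd_intCast_iff.2 hn2))),
      MonoidHom.mul_apply, ih h.of_mul_left_right,
      quarticSymbol_natPrime_intCast hℓ hℓ2 h.of_mul_left_left, one_mul]

theorem norm_mul_div_four_modEq {α β : ℤ[i]} (hα : IsCoprime α 2) (hβ : IsCoprime β 2) :
    (α * β).norm / 4 ≡ α.norm / 4 + β.norm / 4 [ZMOD 4] := by
  have h1 := norm_mod_four_eq_one hα
  have h2 := norm_mod_four_eq_one hβ
  rw [Zsqrtd.norm_mul, Int.ModEq]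
  nth_rw 1 [← Int.mul_ediv_add_emod α.norm 4, ← Int.mul_ediv_add_emod β.norm 4, h1, h2]
  ring_nf
  omega

theorem quarticSymbol_imagUnit {ω : ℤ[i]} (h : IsCoprime ω 2) :
    quarticSymbol ω imagUnit = imagPow (ω.norm / 4) := by
  induction ω using UniqueFactorizationMonoid.induction_on_prime with
  | h₁ => exact absurd rfl (ne_zero_of_isCoprime_two h)
  | h₂ u hu =>
    rw [quarticSymbol_of_isUnit hu, (Zsqrtd.norm_eq_one_iff' (by norm_num) u).2 hu]
    rfl
  | h₃ ω π hω hπ ih =>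
    obtain ⟨hπ2, hω2⟩ := IsCoprime.mul_left_iff.1 h
    have hprime : primeQuarticSymbol π imagUnit = imagPow (π.norm / 4) := by
      rw [← natCast_natAbs_norm_div_four, imagPow_natCast]
      refine (PrimeNotDvdTwo.of_dvd hπ hπ2 dvd_rfl).symbol_eq ?_
        (by rw [sub_self]; exact dvd_zero _)
      rw [← pow_mul, mul_comm, pow_mul, show imagUnit ^ 5 = imagUnit from rfl]
    rw [quarticSymbol_mul hπ.ne_zero hω, MonoidHom.mul_apply, quarticSymbol_of_prime hπ, hprime,
      ih hω2, imagPow_congr (norm_mul_div_four_modEq hπ2 hω2), imagPow_add]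

section ResidueField

variable {p : ℕ} [Fact p.Prime] {π : ℤ[i]} (hN : π.norm = p)
include hN

theorem re_sq_add_im_sq_eq_zero : (π.re : ZMod p) ^ 2 + (π.im : ZMod p) ^ 2 = 0 := by
  have h := congrArg (Int.cast : ℤ → ZMod p) hN
  rw [norm_eq_sq_add_sq] at h
  simpa using h

theorem re_ne_zero_of_norm_eq : (π.re : ZMod p) ≠ 0 := by
  intro hre
  have him : (π.im : ZMod p) = 0 := by simpa [hre] using re_sq_add_im_sq_eq_zero hN
  rw [ZMod.intCast_zmod_eq_zero_iff_dvd] at hre him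
  have hdvd : (p : ℤ) * p ∣ p := by
    have := dvd_add (pow_dvd_pow_of_dvd hre 2) (pow_dvd_pow_of_dvd him 2)
    rwa [← norm_eq_sq_add_sq, hN, sq] at this
  have hp := Nat.prime_iff_prime_int.1 (Fact.out : p.Prime)
  exact hp.not_isUnit (hp.irreducible.squarefree _ hdvd)

theorem im_div_re_mul_self : (π.im : ZMod p) / π.re * (π.im / π.re) = ((-1 : ℤ) : ZMod p) := by
  have hre := re_ne_zero_of_norm_eq hN
  field_simp
  push_cast
  linear_combination re_sq_add_im_sq_eq_zero hN

/-- The reduction of `ℤ[i]` modulo a prime `π` of prime norm `p`, with residue field identified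
with `ZMod p`; since `π` is sent to `0`, the image of `i` is `π.im / π.re`. -/
def residueHom : ℤ[i] →+* ZMod p :=
  Zsqrtd.lift ⟨(π.im : ZMod p) / π.re, im_div_re_mul_self hN⟩

theorem residueHom_apply (α : ℤ[i]) :
    residueHom hN α = α.re + α.im * ((π.im : ZMod p) / π.re) := rfl

theorem residueHom_imagUnit : residueHom hN imagUnit = (π.im : ZMod p) / π.re := by
  simp [residueHom_apply, imagUnit]

theorem residueHom_eq_zero_iff {α : ℤ[i]} : residueHom hN α = 0 ↔ π ∣ α := by
  have hπ0 : residueHom hN π = 0 := by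
    have hre := re_ne_zero_of_norm_eq hN
    rw [residueHom_apply]
    field_simp
    rw [mul_zero]
    exact re_sq_add_im_sq_eq_zero hN
  constructor
  · intro hα
    by_contra hd
    have hπ := prime_of_norm_eq_natPrime Fact.out hN
    obtain ⟨u, v, huv⟩ := hπ.irreducible.coprime_iff_not_dvd.2 hd
    have := congrArg (residueHom hN) huv
    simp [hπ0, hα] at this
  · rintro ⟨β, rfl⟩
    rw [map_mul, hπ0, zero_mul]

theorem residueHom_quarticSymbol (hp4 : p % 4 = 1) (α : ℤ[i]) :
    residueHom hN (quarticSymbol π α) = residueHom hN α ^ (p / 4) := by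
  have hπ := PrimeNotDvdTwo.of_norm_eq Fact.out hp4 hN
  have h := (hπ.symbol_pow_five_and_dvd α).2
  rw [← residueHom_eq_zero_iff hN, map_sub, map_pow, sub_eq_zero, hN, Int.natAbs_natCast] at h
  rw [h, quarticSymbol_of_prime hπ.prime]

theorem quarticSymbol_congr_of_intCast_eq {a b : ℤ} (h : (a : ZMod p) = b) :
    quarticSymbol π a = quarticSymbol π b := by
  refine quarticSymbol_congr ?_
  rw [← residueHom_eq_zero_iff hN, map_sub, map_intCast, map_intCast, h, sub_self]

end ResidueField

section QuarticChar

variable {p : ℕ} [Fact p.Prime] {π : ℤ[i]} (hN : π.norm = p) (hp4 : p % 4 = 1)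

/-- The quartic residue symbol modulo a prime `π` of prime norm `p`, restricted to rational
integers, as a multiplicative character of the residue field `ZMod p`. -/
noncomputable def quarticChar : MulChar (ZMod p) ℤ[i] where
  toFun a := quarticSymbol π (a.val : ℤ)
  map_one' := (quarticSymbol_congr_of_intCast_eq hN (b := 1) (by simp)).trans (by simp)
  map_mul' a b := by
    rw [← map_mul, ← Int.cast_mul]
    exact quarticSymbol_congr_of_intCast_eq hN (by simp)
  map_nonunit' a ha := by
    have hπ := PrimeNotDvdTwo.of_norm_eq Fact.out hp4 hN
    rw [isUnit_iff_ne_zero, not_not] at ha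
    rw [ha, quarticSymbol_of_prime hπ.prime, hπ.symbol_eq_zero_iff]
    simp

theorem quarticChar_intCast (a : ℤ) : quarticChar hN hp4 (a : ZMod p) = quarticSymbol π a :=
  quarticSymbol_congr_of_intCast_eq hN (by simp)

theorem residueHom_quarticChar (a : ZMod p) :
    residueHom hN (quarticChar hN hp4 a) = a ^ (p / 4) := by
  obtain ⟨a, rfl⟩ := ZMod.intCast_surjective a
  rw [quarticChar_intCast, residueHom_quarticSymbol hN hp4, map_intCast]

theorem quarticChar_pow_four : quarticChar hN hp4 ^ 4 = 1 :=
  MulChar.ext fun a => by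
    rw [MulChar.pow_apply_coe, MulChar.one_apply_coe]
    refine (pow_five_eq_self_iff.1 (quarticSymbol_pow_five π _)).resolve_left fun h => ?_
    have ha := residueHom_quarticChar hN hp4 (a : ZMod p)
    rw [show quarticChar hN hp4 (a : ZMod p) = 0 from h, map_zero] at ha
    exact a.ne_zero (eq_zero_of_pow_eq_zero ha.symm)

theorem quarticChar_sq_ne_one : quarticChar hN hp4 ^ 2 ≠ 1 := by
  obtain ⟨a, ha⟩ := FiniteField.exists_nonsquare (F := ZMod p)
    (by rw [ZMod.ringChar_zmod_n]; omega)
  have ha0 : a ≠ 0 := by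
    rintro rfl
    exact ha ⟨0, by simp⟩
  intro h
  have h1 : residueHom hN ((quarticChar hN hp4 ^ 2) a) = 1 := by
    rw [h, MulChar.one_apply ha0.isUnit, map_one]
  rw [MulChar.pow_apply' _ two_ne_zero, map_pow, residueHom_quarticChar, ← pow_mul,
    show p / 4 * 2 = p / 2 by omega] at h1
  exact ha ((ZMod.euler_criterion p ha0).2 h1)

end QuarticChar

section JacobiSum

variable {F : Type*} [Field F]

theorem sum_eval_eq_zero_of_natDegree_lt [Fintype F] {P : Polynomial F}
    (hP : P.natDegree < Fintype.card F - 1) : ∑ x, P.eval x = 0 := by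
  simp_rw [Polynomial.eval_eq_sum_range' hP]
  rw [Finset.sum_comm]
  refine Finset.sum_eq_zero fun k hk => ?_
  rw [← Finset.mul_sum, FiniteField.sum_pow_lt_card_sub_one _ _ (Finset.mem_range.1 hk), mul_zero]

variable {χ : MulChar F ℤ[i]} (hχ4 : χ ^ 4 = 1)
include hχ4

theorem mulChar_inv_eq_star (a : F) : χ⁻¹ a = star (χ a) := by
  by_cases hu : IsUnit a
  · obtain ⟨a, rfl⟩ := hu
    have h4 : χ a ^ 4 = 1 := by rw [← MulChar.pow_apply_coe, hχ4, MulChar.one_apply_coe]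
    have hinv : χ⁻¹ a * χ a = 1 := by
      rw [← MulChar.mul_apply, inv_mul_cancel, MulChar.one_apply_coe]
    linear_combination star (χ a) * hinv - χ⁻¹ a * mul_star_of_pow_four_eq_one h4
  · rw [MulChar.map_nonunit _ hu, MulChar.map_nonunit _ hu, star_zero]

theorem ringHomComp_sq_ne_one (hχ2 : χ ^ 2 ≠ 1) {R : Type*} [CommRing R] (φ : ℤ[i] →+* R)
    (h2 : (2 : R) ≠ 0) : χ.ringHomComp φ ^ 2 ≠ 1 := by
  obtain ⟨a, ha⟩ := MulChar.ne_one_iff.1 hχ2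
  have hneg : (χ ^ 2) (a : F) = -1 := by
    refine (sq_eq_one_iff.1 ?_).resolve_left ha
    rw [← MulChar.pow_apply_coe, ← pow_mul, hχ4, MulChar.one_apply_coe]
  intro h
  have h1 : φ ((χ ^ 2) a) = 1 := by
    rw [← MulChar.ringHomComp_apply, ← MulChar.ringHomComp_pow, h, MulChar.one_apply_coe]
  rw [hneg, map_neg, map_one] at h1
  exact h2 (by linear_combination -h1)

variable [Fintype F]

theorem jacobiSum_inv_eq_star : jacobiSum χ⁻¹ χ⁻¹ = star (jacobiSum χ χ) := by
  rw [jacobiSum, jacobiSum, star_sum]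
  refine Finset.sum_congr rfl fun x _ => ?_
  rw [mulChar_inv_eq_star hχ4, mulChar_inv_eq_star hχ4, star_mul, mul_comm]

open GaussianInt in
theorem norm_jacobiSum_self (hχ2 : χ ^ 2 ≠ 1) : (jacobiSum χ χ).norm = Fintype.card F := by
  have hsq := ringHomComp_sq_ne_one hχ4 hχ2 toComplex two_ne_zero
  have hne : χ.ringHomComp toComplex ≠ 1 := fun h => hsq (by rw [h, one_pow])
  have hchar : ringChar ℂ ≠ ringChar F := by
    rw [ringChar.eq_zero]
    exact (CharP.char_ne_zero_of_finite F (ringChar F)).symm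
  have h := jacobiSum_mul_jacobiSum_inv hchar hne hne (by rwa [← sq])
  rw [MulChar.ringHomComp_inv, jacobiSum_ringHomComp, jacobiSum_ringHomComp,
    jacobiSum_inv_eq_star hχ4, ← map_mul, ← Zsqrtd.norm_eq_mul_conj, map_intCast] at h
  exact_mod_cast h

theorem odd_jacobiSum_self (hF : 4 ∣ Fintype.card F - 1) : Odd (jacobiSum χ χ) := by
  have hprim : IsPrimitiveRoot imagUnit 4 := by
    rw [IsPrimitiveRoot.iff (by norm_num)]
    refine ⟨imagUnit_pow_four, fun k hk hk4 => ?_⟩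
    interval_cases k <;> decide
  obtain ⟨z, -, hz⟩ := exists_jacobiSum_eq_neg_one_add (by norm_num) hχ4 hχ4 hF hprim
  exact ⟨-1 - z * imagUnit, by linear_combination hz + z * imagUnit_sq⟩

end JacobiSum

section GaussSum

variable {F K : Type*} [Field F] [Fintype F] [Field K] {χ : MulChar F K} (hχ4 : χ ^ 4 = 1)
  (hχ2 : χ ^ 2 ≠ 1) {ψ : AddChar F K} (hψ : ψ.IsPrimitive)

include hχ4 hχ2 hψ in
theorem gaussSum_pow_four : gaussSum χ ψ ^ 4 = Fintype.card F * jacobiSum χ χ ^ 2 := by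
  have hquad : (χ ^ 2).IsQuadratic := by
    intro a
    by_cases hu : IsUnit a
    · right
      rw [← sq_eq_one_iff, ← MulChar.pow_apply' _ two_ne_zero, ← pow_mul, hχ4,
        MulChar.one_apply hu]
    · exact Or.inl (MulChar.map_nonunit _ hu)
  have hneg : (χ ^ 2) (-1) = 1 := by
    rw [MulChar.pow_apply' _ two_ne_zero, ← map_pow, neg_one_sq, map_one]
  have hsq : gaussSum (χ ^ 2) ψ ^ 2 = Fintype.card F := by
    rw [gaussSum_sq hχ2 hquad hψ, hneg, one_mul]
  calc gaussSum χ ψ ^ 4 = (gaussSum χ ψ * gaussSum χ ψ) ^ 2 := by ring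
    _ = (gaussSum (χ ^ 2) ψ * jacobiSum χ χ) ^ 2 := by
      rw [sq χ] at hχ2 ⊢
      rw [jacobiSum_mul_nontrivial hχ2]
    _ = Fintype.card F * jacobiSum χ χ ^ 2 := by rw [mul_pow, hsq]

variable {ℓ : ℕ} [Fact ℓ.Prime] [CharP K ℓ] (hℓ : (ℓ : F) ≠ 0)

include hℓ in
theorem mul_gaussSum_pow_char (χ : MulChar F K) (ψ : AddChar F K) :
    (χ ^ ℓ) ℓ * gaussSum χ ψ ^ ℓ = gaussSum (χ ^ ℓ) ψ := by
  rw [gaussSum_frob, AddChar.pow_mulShift]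
  exact gaussSum_mulShift (χ ^ ℓ) ψ (Units.mk0 _ hℓ)

include hχ4 hχ2 hψ hℓ

theorem mulChar_mul_pow_eq_one (hF : (Fintype.card F : K) ≠ 0) (hℓ4 : ℓ % 4 = 1) :
    χ ℓ * (Fintype.card F * jacobiSum χ χ ^ 2) ^ (ℓ / 4) = 1 := by
  have hχℓ : χ ^ ℓ = χ := by
    nth_rw 1 [← Nat.div_add_mod ℓ 4, hℓ4, pow_succ, pow_mul, hχ4, one_pow, one_mul]
  have hne : gaussSum χ ψ ≠ 0 :=
    gaussSum_ne_zero_of_nontrivial hF (fun h => hχ2 (by rw [h, one_pow])) hψ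
  have h := mul_gaussSum_pow_char hℓ χ ψ
  rw [hχℓ] at h
  apply mul_right_cancel₀ hne
  rw [one_mul, ← gaussSum_pow_four hχ4 hχ2 hψ, ← pow_mul, mul_assoc, ← pow_succ,
    show 4 * (ℓ / 4) + 1 = ℓ by omega, h]

theorem pow_eq_mulChar_mul (hℓ4 : ℓ % 4 = 3) :
    (Fintype.card F * jacobiSum χ χ ^ 2) ^ (ℓ / 4 + 1) = χ (-ℓ) * Fintype.card F := by
  have hχℓ : χ ^ ℓ = χ⁻¹ := by
    rw [eq_inv_iff_mul_eq_one, ← pow_succ, show ℓ + 1 = 4 * (ℓ / 4 + 1) by omega, pow_mul, hχ4,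
      one_pow]
  have hfrob := mul_gaussSum_pow_char hℓ χ ψ
  rw [hχℓ] at hfrob
  have hinv : χ ℓ * χ⁻¹ ℓ = 1 := by
    rw [← MulChar.mul_apply, mul_inv_cancel, MulChar.one_apply hℓ.isUnit]
  have hne : χ ≠ 1 := by
    rintro rfl
    exact hχ2 (one_pow 2)
  have hcard : gaussSum χ⁻¹ ψ * gaussSum χ ψ = χ (-1) * Fintype.card F := by
    rw [← mul_gaussSum_inv_eq_gaussSum χ⁻¹ ψ, MulChar.inv_apply', inv_neg_one, mul_assoc,
      mul_comm (gaussSum χ⁻¹ ψ⁻¹), gaussSum_mul_gaussSum_eq_card hne hψ]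
  calc (Fintype.card F * jacobiSum χ χ ^ 2) ^ (ℓ / 4 + 1)
    _ = gaussSum χ ψ ^ ℓ * gaussSum χ ψ := by
      rw [← gaussSum_pow_four hχ4 hχ2 hψ, ← pow_mul, show 4 * (ℓ / 4 + 1) = ℓ + 1 by omega,
        pow_succ]
    _ = χ ℓ * gaussSum χ⁻¹ ψ * gaussSum χ ψ := by
      rw [← hfrob]
      linear_combination - gaussSum χ ψ ^ ℓ * gaussSum χ ψ * hinv
    _ = χ (-ℓ) * Fintype.card F := by
      rw [mul_assoc, hcard, ← mul_assoc, ← map_mul, mul_neg_one]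

end GaussSum

theorem natCast_ne_zero_of_ne {R : Type*} [Ring R] {q r : ℕ} [CharP R q] (hq : q.Prime)
    (hr : r.Prime) (h : q ≠ r) : (r : R) ≠ 0 := by
  rw [ne_eq, CharP.cast_eq_zero_iff R q, Nat.prime_dvd_prime_iff_eq hq hr]
  exact h

section QuarticJacobiSum

variable {p : ℕ} [Fact p.Prime] {π : ℤ[i]} (hN : π.norm = p) (hp4 : p % 4 = 1)

theorem dvd_jacobiSum_quarticChar :
    π ∣ jacobiSum (quarticChar hN hp4) (quarticChar hN hp4) := by
  let P : Polynomial (ZMod p) := Polynomial.X ^ (p / 4) * (1 - Polynomial.X) ^ (p / 4)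
  have hP : P.natDegree < Fintype.card (ZMod p) - 1 := by
    have h1 : (1 - Polynomial.X : Polynomial (ZMod p)).natDegree ≤ 1 :=
      (Polynomial.natDegree_sub_le _ _).trans (by simp)
    have h2 : P.natDegree ≤ p / 4 + p / 4 * 1 :=
      Polynomial.natDegree_mul_le_of_le (Polynomial.natDegree_X_pow_le _)
        (Polynomial.natDegree_pow_le_of_le _ h1)
    have := (Fact.out : p.Prime).one_lt
    rw [ZMod.card]
    omega
  rw [← residueHom_eq_zero_iff hN, jacobiSum, map_sum, ← sum_eval_eq_zero_of_natDegree_lt hP]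
  refine Finset.sum_congr rfl fun x _ => ?_
  rw [map_mul, residueHom_quarticChar, residueHom_quarticChar]
  simp [P]

theorem jacobiSum_quarticChar_sq (hπ : Odd π) :
    jacobiSum (quarticChar hN hp4) (quarticChar hN hp4) ^ 2 = π ^ 2 := by
  have hχ4 := quarticChar_pow_four hN hp4
  have hnorm := norm_jacobiSum_self hχ4 (quarticChar_sq_ne_one hN hp4)
  have hodd := odd_jacobiSum_self hχ4 (by rw [ZMod.card]; omega)
  obtain ⟨u, hu⟩ := dvd_jacobiSum_quarticChar hN hp4
  rw [hu] at hnorm hodd ⊢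
  have hunit : IsUnit u := by
    rw [Zsqrtd.norm_mul, hN, ZMod.card] at hnorm
    rw [← Zsqrtd.norm_eq_one_iff' (by norm_num)]
    exact mul_left_cancel₀ (by exact_mod_cast (Fact.out : p.Prime).ne_zero)
      (hnorm.trans (mul_one _).symm)
  rcases eq_one_or_neg_one_of_isUnit_of_odd hunit (odd_of_odd_mul hπ hodd) with rfl | rfl <;> ring

variable {K : Type*} [Field K] (φ : ℤ[i] →+* K) (hK : (2 : K) ≠ 0) (hπ : Odd π)
  {ψ : AddChar (ZMod p) K} (hψ : ψ.IsPrimitive)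
  {ℓ : ℕ} [Fact ℓ.Prime] [CharP K ℓ] (hℓp : ℓ ≠ p)

theorem ringHomComp_quarticChar_pow_four : (quarticChar hN hp4).ringHomComp φ ^ 4 = 1 := by
  rw [MulChar.ringHomComp_pow, quarticChar_pow_four, MulChar.ringHomComp_one]

include hπ in
theorem card_mul_jacobiSum_ringHomComp_sq :
    (Fintype.card (ZMod p) : K) * jacobiSum ((quarticChar hN hp4).ringHomComp φ)
      ((quarticChar hN hp4).ringHomComp φ) ^ 2 = φ (π ^ 3 * star π) := by
  have hp : ((p : ℕ) : K) = φ (π * star π) := by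
    rw [← Zsqrtd.norm_eq_mul_conj, hN, map_intCast, Int.cast_natCast]
  rw [jacobiSum_ringHomComp, ← map_pow, jacobiSum_quarticChar_sq hN hp4 hπ, ZMod.card, hp,
    ← map_mul]
  congr 1
  ring

include hN hp4 hK hπ hψ hℓp

theorem quarticSymbol_natPrime_mul_pow_eq_one (hℓ4 : ℓ % 4 = 1) :
    φ (quarticSymbol π ℓ) * φ (π ^ 3 * star π) ^ (ℓ / 4) = 1 := by
  have h := mulChar_mul_pow_eq_one (ringHomComp_quarticChar_pow_four hN hp4 φ)
    (ringHomComp_sq_ne_one (quarticChar_pow_four hN hp4) (quarticChar_sq_ne_one hN hp4) φ hK) hψ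
    (natCast_ne_zero_of_ne Fact.out Fact.out hℓp.symm)
    (by rw [ZMod.card]; exact natCast_ne_zero_of_ne Fact.out Fact.out hℓp) hℓ4
  rw [card_mul_jacobiSum_ringHomComp_sq hN hp4 φ hπ, MulChar.ringHomComp_apply] at h
  have hℓ := quarticChar_intCast hN hp4 ℓ
  rw [Int.cast_natCast, Int.cast_natCast] at hℓ
  rwa [hℓ] at h

theorem pow_eq_quarticSymbol_neg_natPrime (hℓ4 : ℓ % 4 = 3) :
    φ (π ^ 3 * star π) ^ (ℓ / 4 + 1) = φ (quarticSymbol π (-ℓ)) * φ (π * star π) := by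
  have h := pow_eq_mulChar_mul (ringHomComp_quarticChar_pow_four hN hp4 φ)
    (ringHomComp_sq_ne_one (quarticChar_pow_four hN hp4) (quarticChar_sq_ne_one hN hp4) φ hK) hψ
    (natCast_ne_zero_of_ne Fact.out Fact.out hℓp.symm) hℓ4
  rw [card_mul_jacobiSum_ringHomComp_sq hN hp4 φ hπ, MulChar.ringHomComp_apply, ZMod.card] at h
  have hℓ := quarticChar_intCast hN hp4 (-ℓ)
  rw [Int.cast_neg, Int.cast_natCast, Int.cast_neg, Int.cast_natCast] at hℓ
  rw [h, hℓ, ← Zsqrtd.norm_eq_mul_conj, hN, map_intCast, Int.cast_natCast]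

end QuarticJacobiSum

theorem exists_field_with_primitive_addChar {p ℓ : ℕ} [Fact p.Prime] [Fact ℓ.Prime] (hℓp : ℓ ≠ p)
    {Λ : ℤ[i]} (hΛ : Prime Λ) (hΛℓ : Λ ∣ ℓ) :
    ∃ (K : Type) (_ : Field K) (_ : CharP K ℓ) (φ : ℤ[i] →+* K) (ψ : AddChar (ZMod p) K),
      ψ.IsPrimitive ∧ ∀ α, φ α = 0 ↔ Λ ∣ α := by
  have hmax : (Ideal.span {Λ}).IsMaximal :=
    PrincipalIdealRing.isMaximal_of_irreducible hΛ.irreducible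
  let k := ℤ[i] ⧸ Ideal.span {Λ}
  let _ : Field k := Ideal.Quotient.field _
  let mk : ℤ[i] →+* k := Ideal.Quotient.mk (Ideal.span {Λ})
  have hmk (α : ℤ[i]) : mk α = 0 ↔ Λ ∣ α := by
    rw [Ideal.Quotient.eq_zero_iff_mem, Ideal.mem_span_singleton]
  have hk : ringChar k = ℓ :=
    CharP.ringChar_of_prime_eq_zero Fact.out (by rw [← map_natCast mk, hmk]; exact hΛℓ)
  have hchar : CharP k ℓ := ringChar.eq_iff.1 hk
  let ψ := AddChar.FiniteField.primitiveChar (ZMod p) k (by rwa [hk, ZMod.ringChar_zmod_n])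
  refine ⟨CyclotomicField ψ.n k, inferInstance,
    charP_of_injective_algebraMap (algebraMap k _).injective ℓ, (algebraMap k _).comp mk,
    ψ.char, ψ.prim, fun α => ?_⟩
  rw [RingHom.comp_apply, map_eq_zero, hmk]

section PrimeReciprocity

variable {p : ℕ} {π : ℤ[i]} (hp : p.Prime) (hp4 : p % 4 = 1) (hN : π.norm = p) (hπ : Odd π)
  {ℓ : ℕ} (hℓ : ℓ.Prime) (hℓp : ℓ ≠ p)
include hp hp4 hN hπ hℓ hℓp

theorem quarticSymbol_natPrime_eq_of_mod_four_eq_one (hℓ4 : ℓ % 4 = 1) :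
    quarticSymbol π ℓ = quarticSymbol ℓ π := by
  have := Fact.mk hp
  have := Fact.mk hℓ
  obtain ⟨Λ, hΛN⟩ := exists_norm_eq_natPrime hℓ hℓ4
  have hΛ := PrimeNotDvdTwo.of_norm_eq hℓ hℓ4 hΛN
  have hℓΛ : (ℓ : ℤ[i]) = Λ * star Λ := by rw [← Zsqrtd.norm_eq_mul_conj, hΛN, Int.cast_natCast]
  obtain ⟨K, _, _, φ, ψ, hψ, hφ⟩ :=
    exists_field_with_primitive_addChar hℓp hΛ.prime (hℓΛ ▸ dvd_mul_right Λ _)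
  have hK : (2 : K) ≠ 0 := by
    rw [← map_ofNat φ 2, ne_eq, hφ]
    exact hΛ.not_dvd_two
  have hone : quarticSymbol π ℓ * quarticSymbol Λ (π ^ 3 * star π) = 1 := by
    rw [quarticSymbol_of_prime hΛ.prime]
    obtain ⟨h5, hdvd⟩ := hΛ.symbol_pow_five_and_dvd (π ^ 3 * star π)
    rw [← hφ, map_sub, sub_eq_zero, map_pow, hΛN, Int.natAbs_natCast] at hdvd
    refine hΛ.eq_of_pow_five_eq_self (by rw [mul_pow, quarticSymbol_pow_five, h5]) (one_pow 5) ?_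
    rw [← hφ, map_sub, map_mul, ← hdvd, map_one, sub_eq_zero]
    exact quarticSymbol_natPrime_mul_pow_eq_one hN hp4 φ hK hπ hψ hℓp hℓ4
  have hstar : quarticSymbol (star Λ) π = star (quarticSymbol Λ (star π)) := by
    rw [quarticSymbol_of_prime hΛ.prime, ← hΛ.symbol_star, star_star,
      quarticSymbol_of_prime hΛ.conj.prime]
  rw [hℓΛ, quarticSymbol_mul hΛ.prime.ne_zero hΛ.conj.prime.ne_zero, MonoidHom.mul_apply, hstar,
    ← hℓΛ]
  rw [map_mul, map_pow] at hone
  set s := quarticSymbol Λ π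
  set t := quarticSymbol Λ (star π)
  have hs : s ^ 4 = 1 := isUnit_iff_pow_four_eq_one.1
    (.of_mul_eq_one (quarticSymbol π ℓ * (s ^ 2 * t)) (by linear_combination hone))
  have ht : t * star t = 1 := mul_star_of_pow_four_eq_one (isUnit_iff_pow_four_eq_one.1
    (.of_mul_eq_one (quarticSymbol π ℓ * s ^ 3) (by linear_combination hone)))
  linear_combination s * star t * hone - quarticSymbol π ℓ * (t * star t * hs + ht)

theorem quarticSymbol_neg_natPrime_eq_of_mod_four_eq_three (hℓ4 : ℓ % 4 = 3) :
    quarticSymbol π (-ℓ) = quarticSymbol ℓ π := by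
  have := Fact.mk hp
  have := Fact.mk hℓ
  have hprime := GaussianInt.prime_of_nat_prime_of_mod_four_eq_three ℓ hℓ4
  have hℓ2 := PrimeNotDvdTwo.of_odd hprime (Nat.odd_iff.2 (by omega)).natCast
  obtain ⟨K, _, _, φ, ψ, hψ, hφ⟩ := exists_field_with_primitive_addChar hℓp hprime dvd_rfl
  have hK : (2 : K) ≠ 0 := by
    rw [← map_ofNat φ 2, ne_eq, hφ]
    exact hℓ2.not_dvd_two
  have hgauss := pow_eq_quarticSymbol_neg_natPrime hN hp4 φ hK hπ hψ hℓp hℓ4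
  have hstar : φ (star π) = φ π ^ ℓ := by
    rw [← map_pow, ← sub_eq_zero, ← map_sub, hφ, dvd_sub_comm]
    exact natPrime_dvd_pow_sub_star hℓ hℓ4 π
  have hπ0 : φ π ≠ 0 := by
    intro h0
    have hp0 : φ (π * star π) = 0 := by rw [map_mul, h0, zero_mul]
    rw [← Zsqrtd.norm_eq_mul_conj, hN, map_intCast, Int.cast_natCast] at hp0
    exact natCast_ne_zero_of_ne hℓ hp hℓp hp0
  rw [quarticSymbol_of_prime hprime]
  refine (hℓ2.symbol_eq (quarticSymbol_pow_five π _) ?_).symm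
  rw [← hφ, map_sub, map_pow, sub_eq_zero]
  apply mul_right_cancel₀ (pow_ne_zero (ℓ + 1) hπ0)
  rw [map_mul, map_mul, map_pow, hstar, ← pow_succ', ← pow_add, ← pow_mul] at hgauss
  rw [← hgauss, ← pow_add, Zsqrtd.norm_natCast, Int.natAbs_mul, Int.natAbs_natCast]
  congr 1
  obtain ⟨k, rfl⟩ : ∃ k, ℓ = 4 * k + 3 := ⟨ℓ / 4, by omega⟩
  rw [show (4 * k + 3) * (4 * k + 3) = 1 + 4 * ((4 * k + 2) * (k + 1)) by ring,
    Nat.add_mul_div_left _ _ (by norm_num), show (4 * k + 3) / 4 = k by omega]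
  simp only [Nat.reduceDiv, zero_add]
  ring

end PrimeReciprocity

theorem quarticSymbol_neg_one {ω : ℤ[i]} (h : IsCoprime ω 2) :
    quarticSymbol ω (-1) = imagPow (ω.norm / 4 * 2) := by
  rw [← imagUnit_sq, map_pow, quarticSymbol_imagUnit h, ← imagPow_mul_natCast, Nat.cast_ofNat]

theorem even_sq_div_four_of_odd {a : ℤ} (ha : Odd a) : Even (a ^ 2 / 4) := by
  have := Int.eight_dvd_sq_sub_one_of_odd ha
  rw [Int.even_iff]
  omega

theorem quarticSymbol_intCast_imagUnit {a : ℤ} (ha : Odd a) :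
    quarticSymbol a imagUnit = imagPow (a ^ 2 / 4) := by
  rw [quarticSymbol_imagUnit (isCoprime_two_of_odd (odd_intCast_iff.2 ha)), Zsqrtd.norm_intCast, sq]

theorem quarticSymbol_natPrime_of_norm_eq_natPrime {π : ℤ[i]} {p ℓ : ℕ} (hp : p.Prime)
    (hp4 : p % 4 = 1) (hN : π.norm = p) (hπ : Odd π) (hℓ : ℓ.Prime) (hℓ2 : Odd ℓ) :
    quarticSymbol π ℓ = imagPow ((ℓ - 1) * (π.norm / 4)) * quarticSymbol ℓ π := by
  have hπ2 := isCoprime_two_of_odd hπ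
  by_cases hℓp : ℓ = p
  · have hprime := prime_of_norm_eq_natPrime hp hN
    have hdvd : π ∣ (ℓ : ℤ[i]) := by simpa [hN, hℓp] using dvd_norm π
    have h1 : ¬ IsCoprime π (ℓ : ℤ[i]) := fun h => hprime.not_isUnit (h.isUnit_of_dvd' dvd_rfl hdvd)
    rw [(quarticSymbol_eq_zero_iff hπ2).2 h1,
      (quarticSymbol_eq_zero_iff (isCoprime_two_of_odd hℓ2.natCast)).2 fun h => h1 h.symm, mul_zero]
  rcases Nat.odd_mod_four_iff.1 (Nat.odd_iff.1 hℓ2) with h4 | h4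
  · have hexp : ((ℓ : ℤ) - 1) * (π.norm / 4) ≡ 0 [ZMOD 4] := by
      refine Int.modEq_zero_iff_dvd.2 (Dvd.dvd.mul_right ?_ _)
      omega
    rw [quarticSymbol_natPrime_eq_of_mod_four_eq_one hp hp4 hN hπ hℓ hℓp h4, imagPow_congr hexp,
      imagPow_zero, one_mul]
  · have hexp : π.norm / 4 * 2 ≡ ((ℓ : ℤ) - 1) * (π.norm / 4) [ZMOD 4] := by
      rw [mul_comm]
      exact Int.ModEq.mul_right _ (by rw [Int.ModEq]; omega)
    rw [← imagPow_congr hexp, ← quarticSymbol_neg_one hπ2,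
      ← quarticSymbol_neg_natPrime_eq_of_mod_four_eq_three hp hp4 hN hπ hℓ hℓp h4, ← map_mul,
      neg_one_mul, neg_neg]

theorem quarticSymbol_intCast_of_norm_eq_natPrime {π : ℤ[i]} {p : ℕ} (hp : p.Prime)
    (hp4 : p % 4 = 1) (hN : π.norm = p) (hπ : Odd π) {n : ℤ} (hn : Odd n) :
    quarticSymbol π n = imagPow ((n - 1) * (π.norm / 4)) * quarticSymbol n π := by
  refine int_odd_induction
    (P := fun n => quarticSymbol π n = imagPow ((n - 1) * (π.norm / 4)) * quarticSymbol n π)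
    ?_ (fun n hn ih => ?_) (fun ℓ n hℓ hℓ2 hn ih => ?_) hn
  · rw [Int.cast_one, map_one, sub_self, zero_mul, imagPow_zero,
      quarticSymbol_of_isUnit isUnit_one, MonoidHom.one_apply, one_mul]
  · have hexp : π.norm / 4 * 2 + (n - 1) * (π.norm / 4) ≡ (-n - 1) * (π.norm / 4) [ZMOD 4] := by
      obtain ⟨k, rfl⟩ := hn
      exact Int.modEq_iff_dvd.2 ⟨-(k + 1) * (π.norm / 4), by ring⟩
    have hneg : ((-n : ℤ) : ℤ[i]) = -1 * n := by rw [Int.cast_neg, neg_one_mul]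
    rw [hneg, map_mul, ih, quarticSymbol_neg_one (isCoprime_two_of_odd hπ), ← mul_assoc,
      ← imagPow_add, imagPow_congr hexp, neg_one_mul, quarticSymbol_neg]
  · have hexp : (ℓ - 1) * (π.norm / 4) + (n - 1) * (π.norm / 4) ≡
        (ℓ * n - 1) * (π.norm / 4) [ZMOD 4] := by
      obtain ⟨j, rfl⟩ := hℓ2
      obtain ⟨k, rfl⟩ := hn
      exact Int.modEq_iff_dvd.2 ⟨j * k * (π.norm / 4), by push_cast; ring⟩
    rw [Int.cast_mul, Int.cast_natCast, map_mul, ih,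
      quarticSymbol_natPrime_of_norm_eq_natPrime hp hp4 hN hπ hℓ hℓ2, mul_mul_mul_comm,
      ← imagPow_add, imagPow_congr hexp, quarticSymbol_mul (by exact_mod_cast hℓ.ne_zero)
        (ne_zero_of_isCoprime_two (isCoprime_two_of_odd (odd_intCast_iff.2 hn))),
      MonoidHom.mul_apply]

theorem quarticSymbol_intCast {ω : ℤ[i]} (hω : Odd ω) {n : ℤ} (hn : Odd n) :
    quarticSymbol ω n = imagPow ((n - 1) * (ω.norm / 4)) * quarticSymbol n ω := by
  refine odd_induction
    (P := fun ω => quarticSymbol ω n = imagPow ((n - 1) * (ω.norm / 4)) * quarticSymbol n ω)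
    (fun m hm => ?_) (fun π p hp hp4 hN hπ => ?_) (fun α β hα hβ ihα ihβ => ?_) hω
  · have hm2 := isCoprime_two_of_odd (odd_intCast_iff.2 hm)
    have hn2 := isCoprime_two_of_odd (odd_intCast_iff.2 hn)
    by_cases h : IsCoprime (m : ℤ[i]) n
    · have hexp : (n - 1) * ((m : ℤ[i]).norm / 4) ≡ 0 [ZMOD 4] := by
        obtain ⟨j, rfl⟩ := hn
        obtain ⟨k, hk⟩ := even_sq_div_four_of_odd hm
        rw [Zsqrtd.norm_intCast, ← sq, hk]
        exact Int.modEq_zero_iff_dvd.2 ⟨j * k, by ring⟩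
      have hmn : IsCoprime m n := isCoprime_intCast_iff.1 h
      rw [quarticSymbol_intCast_intCast hm hmn, quarticSymbol_intCast_intCast hn hmn.symm,
        imagPow_congr hexp, imagPow_zero, one_mul]
    · rw [(quarticSymbol_eq_zero_iff hm2).2 h,
        (quarticSymbol_eq_zero_iff hn2).2 fun h' => h h'.symm, mul_zero]
  · exact quarticSymbol_intCast_of_norm_eq_natPrime hp hp4 hN hπ hn
  · have hα2 := isCoprime_two_of_odd hα
    have hβ2 := isCoprime_two_of_odd hβ
    have hexp := (norm_mul_div_four_modEq hα2 hβ2).mul_left (n - 1)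
    rw [quarticSymbol_mul (ne_zero_of_isCoprime_two hα2) (ne_zero_of_isCoprime_two hβ2),
      MonoidHom.mul_apply, ihα, ihβ, mul_mul_mul_comm, ← imagPow_add, ← map_mul,
      imagPow_congr hexp, mul_add]

theorem quarticSymbol_intCast_of_modEq_one {ω : ℤ[i]} (hω : Odd ω) {n : ℤ} (hn : n ≡ 1 [ZMOD 4]) :
    quarticSymbol ω n = quarticSymbol n ω := by
  have hexp : (n - 1) * (ω.norm / 4) ≡ 0 [ZMOD 4] :=
    Int.modEq_zero_iff_dvd.2 (hn.symm.dvd.mul_right _)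
  have hodd : Odd n := Int.odd_iff.2 (by rw [Int.ModEq] at hn; omega)
  rw [quarticSymbol_intCast hω hodd, imagPow_congr hexp, imagPow_zero, one_mul]

theorem quarticSymbol_intCast_sq {ω : ℤ[i]} (hω : Odd ω) {n : ℤ} (hn : Odd n) :
    quarticSymbol ω n ^ 2 = quarticSymbol n ω ^ 2 := by
  have hexp : (n - 1) * (ω.norm / 4) * (2 : ℕ) ≡ 0 [ZMOD 4] := by
    obtain ⟨k, rfl⟩ := hn
    exact Int.modEq_zero_iff_dvd.2 ⟨k * (ω.norm / 4), by push_cast; ring⟩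
  rw [quarticSymbol_intCast hω hn, mul_pow, ← imagPow_mul_natCast, imagPow_congr hexp, imagPow_zero,
    one_mul]

theorem quarticSymbol_re_sq {ω : ℤ[i]} (hω : Odd ω) (hc : IsCoprime ω.re ω.im) :
    quarticSymbol ω ω.re ^ 2 = 1 := by
  have hre := (odd_iff.1 hω).1
  have hcongr : (ω.re : ℤ[i]) ∣ ω - ω.im * imagUnit :=
    ⟨1, by linear_combination eq_re_add_im_mul_imagUnit ω⟩
  have hexp : ω.re ^ 2 / 4 * (2 : ℕ) ≡ 0 [ZMOD 4] := by
    obtain ⟨k, hk⟩ := even_sq_div_four_of_odd hre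
    exact Int.modEq_zero_iff_dvd.2 ⟨k, by rw [hk]; push_cast; ring⟩
  rw [quarticSymbol_intCast_sq hω hre, quarticSymbol_congr hcongr, map_mul,
    quarticSymbol_intCast_intCast hre hc, one_mul, quarticSymbol_intCast_imagUnit hre,
    ← imagPow_mul_natCast, imagPow_congr hexp, imagPow_zero]

theorem quarticSymbol_re_add_im_sq {ω : ℤ[i]} (hω : Odd ω) (hc : IsCoprime ω.re ω.im) :
    quarticSymbol ω ((ω.re + ω.im : ℤ) : ℤ[i]) ^ 2 = imagPow ((ω.re + ω.im) ^ 2 / 4) := by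
  have hodd : Odd (ω.re + ω.im) := (odd_iff.1 hω).1.add_even (odd_iff.1 hω).2
  have hcop : IsCoprime (ω.re + ω.im) (-2 * ω.im ^ 2) := by
    have him : IsCoprime (ω.re + ω.im) ω.im := by simpa using hc.add_mul_right_left 1
    obtain ⟨k, hk⟩ := hodd
    have htwo : IsCoprime (ω.re + ω.im) (-2) := ⟨1, k, by linear_combination hk⟩
    exact htwo.mul_right him.pow_right
  have hcongr : ((ω.re + ω.im : ℤ) : ℤ[i]) ∣ ω ^ 2 - ((-2 * ω.im ^ 2 : ℤ) : ℤ[i]) * imagUnit := by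
    refine ⟨ω.re - ω.im + 2 * ω.im * imagUnit, ?_⟩
    nth_rw 1 [eq_re_add_im_mul_imagUnit ω]
    push_cast
    linear_combination (ω.im : ℤ[i]) ^ 2 * imagUnit_sq
  rw [quarticSymbol_intCast_sq hω hodd, ← map_pow, quarticSymbol_congr hcongr, map_mul,
    quarticSymbol_intCast_intCast hodd hcop, one_mul, quarticSymbol_intCast_imagUnit hodd]

theorem quarticSymbol_two {ω : ℤ[i]} (hω : Odd ω) (hc : IsCoprime ω.re ω.im) :
    quarticSymbol ω 2 = imagPow (ω.re * ω.im / 2) := by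
  have hcongr : ω ∣ ((ω.re + ω.im : ℤ) : ℤ[i]) ^ 2 - (ω.re : ℤ[i]) ^ 2 * (2 * imagUnit) := by
    refine ⟨ω.re - ω.im * imagUnit - 2 * ω.re * imagUnit, ?_⟩
    push_cast
    linear_combination ((ω.im : ℤ[i]) ^ 2 + 2 * ω.re * ω.im) * imagUnit_sq -
      ((ω.re : ℤ[i]) - ω.im * imagUnit - 2 * ω.re * imagUnit) * eq_re_add_im_mul_imagUnit ω
  have hmul : imagPow ((ω.re + ω.im) ^ 2 / 4) = quarticSymbol ω 2 * imagPow (ω.norm / 4) := by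
    rw [← quarticSymbol_re_add_im_sq hω hc, ← map_pow, quarticSymbol_congr hcongr, map_mul, map_mul,
      map_pow, quarticSymbol_re_sq hω hc, one_mul, quarticSymbol_imagUnit (isCoprime_two_of_odd hω)]
  have hexp : (ω.re + ω.im) ^ 2 / 4 = ω.re * ω.im / 2 + ω.norm / 4 := by
    obtain ⟨k, hk⟩ := (odd_iff.1 hω).2.mul_left ω.re
    have : (ω.re + ω.im) ^ 2 = ω.norm + 2 * (ω.re * ω.im) := by rw [norm_eq_sq_add_sq]; ring
    omega
  rw [hexp, imagPow_add] at hmul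
  exact (mul_right_cancel₀ (imagPow_ne_zero _) hmul).symm

section NormEquation

variable {π : ℤ[i]} {q x y : ℤ}

theorem re_intCast_add_two_mul : ((x : ℤ[i]) + 2 * π).re = x + 2 * π.re := by
  simp

theorem im_intCast_add_two_mul : ((x : ℤ[i]) + 2 * π).im = 2 * π.im := by
  simp

theorem odd_intCast_add_two_mul (hx : Odd x) : Odd ((x : ℤ[i]) + 2 * π) :=
  (odd_intCast_iff.2 hx).add_even (even_two_mul π)

theorem isCoprime_re_im_intCast_add_two_mul (hx : Odd x) (hcop : IsCoprime π.im (x + 2 * π.re)) :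
    IsCoprime ((x : ℤ[i]) + 2 * π).re ((x : ℤ[i]) + 2 * π).im := by
  rw [re_intCast_add_two_mul, im_intCast_add_two_mul]
  obtain ⟨k, rfl⟩ := hx
  have htwo : IsCoprime (2 * k + 1 + 2 * π.re) 2 := ⟨1, -(k + π.re), by ring⟩
  exact htwo.mul_right hcop.symm

theorem quarticSymbol_intCast_add_two_mul_self (hx : Odd x) :
    quarticSymbol x (x + 2 * π) = quarticSymbol x π := by
  have hcongr : (x : ℤ[i]) ∣ x + 2 * π - (2 : ℤ) * π := ⟨1, by push_cast; ring⟩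
  have htwo : IsCoprime x 2 := Int.isCoprime_two_right.2 hx
  rw [quarticSymbol_congr hcongr, map_mul, quarticSymbol_intCast_intCast hx htwo, one_mul]

theorem quarticSymbol_re_intCast_add_two_mul (hx : Odd x)
    (hcop : IsCoprime π.im (x + 2 * π.re)) :
    quarticSymbol ((x + 2 * π.re : ℤ) : ℤ[i]) (x + 2 * π) = imagPow ((x + 2 * π.re) ^ 2 / 4) := by
  have hodd : Odd (x + 2 * π.re) := hx.add_even (even_two_mul _)
  have hcongr : ((x + 2 * π.re : ℤ) : ℤ[i]) ∣ x + 2 * π - ((2 * π.im : ℤ) : ℤ[i]) * imagUnit := by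
    refine ⟨1, ?_⟩
    push_cast
    linear_combination 2 * eq_re_add_im_mul_imagUnit π
  have h := isCoprime_re_im_intCast_add_two_mul hx hcop
  rw [re_intCast_add_two_mul, im_intCast_add_two_mul] at h
  rw [quarticSymbol_congr hcongr, map_mul, quarticSymbol_intCast_intCast hodd h, one_mul,
    quarticSymbol_intCast_imagUnit hodd]

theorem quarticSymbol_two_intCast_add_two_mul (hx : Odd x)
    (hcop : IsCoprime π.im (x + 2 * π.re)) :
    quarticSymbol (x + 2 * π) 2 = imagPow ((x + 2 * π.re) * π.im) := by
  rw [quarticSymbol_two (odd_intCast_add_two_mul hx) (isCoprime_re_im_intCast_add_two_mul hx hcop),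
    re_intCast_add_two_mul, im_intCast_add_two_mul, mul_left_comm,
    Int.mul_ediv_cancel_left _ two_ne_zero]

theorem quarticSymbol_intCast_add_two_mul_mul_re (hπ : Odd π.norm) (hx : Odd x)
    (hcop : IsCoprime π.im (x + 2 * π.re)) :
    quarticSymbol (x + 2 * π) ((x * (x + 2 * π.re) : ℤ) : ℤ[i]) =
      imagPow ((x + 2 * π.re) ^ 2 / 4) * quarticSymbol x π := by
  have hA : Odd (x + 2 * π.re) := hx.add_even (even_two_mul _)
  have hexp : (x * (x + 2 * π.re) - 1) * (((x : ℤ[i]) + 2 * π).norm / 4) ≡ 0 [ZMOD 4] := by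
    have hN : ((x : ℤ[i]) + 2 * π).norm / 4 = (x + 2 * π.re) ^ 2 / 4 + π.im ^ 2 := by
      rw [norm_eq_sq_add_sq, re_intCast_add_two_mul, im_intCast_add_two_mul, mul_pow]
      omega
    have hre_im : Even (π.re * π.im) := by
      rw [norm_eq_sq_add_sq, Int.odd_add] at hπ
      grind
    obtain ⟨s, hs⟩ := even_sq_div_four_of_odd hA
    obtain ⟨t, ht⟩ := hre_im
    obtain ⟨u, hu⟩ := Int.eight_dvd_sq_sub_one_of_odd hx
    obtain ⟨k, rfl⟩ := hx
    rw [hN, hs]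
    refine Int.modEq_zero_iff_dvd.2 ⟨s * (2 * k ^ 2 + 2 * k + (2 * k + 1) * π.re) +
      2 * u * π.im ^ 2 + (2 * k + 1) * t * π.im, ?_⟩
    linear_combination π.im ^ 2 * hu + 2 * (2 * k + 1) * π.im * ht
  have hx0 : (x : ℤ[i]) ≠ 0 :=
    ne_zero_of_isCoprime_two (isCoprime_two_of_odd (odd_intCast_iff.2 hx))
  have hA0 : ((x + 2 * π.re : ℤ) : ℤ[i]) ≠ 0 :=
    ne_zero_of_isCoprime_two (isCoprime_two_of_odd (odd_intCast_iff.2 hA))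
  rw [quarticSymbol_intCast (odd_intCast_add_two_mul hx) (hx.mul hA), imagPow_congr hexp,
    imagPow_zero, one_mul, Int.cast_mul, quarticSymbol_mul hx0 hA0, MonoidHom.mul_apply,
    quarticSymbol_intCast_add_two_mul_self hx, quarticSymbol_re_intCast_add_two_mul hx hcop,
    mul_comm]

section

variable (hxy : 4 * π.norm = x ^ 2 + q * y ^ 2)
include hxy

theorem isCoprime_re_of_four_mul_norm_eq (hx : Odd x) (hcop : IsCoprime π.im (x + 2 * π.re)) :
    IsCoprime (x + 2 * π.re) y := by
  have h := (isCoprime_re_im_intCast_add_two_mul hx hcop).pow_right (n := 2)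
  rw [re_intCast_add_two_mul, im_intCast_add_two_mul] at h
  have hqy : (2 * π.im) ^ 2 + (x + 2 * π.re) * (2 * π.re - x) = y * (y * q) := by
    rw [norm_eq_sq_add_sq] at hxy
    linear_combination hxy
  have := h.add_mul_left_right (2 * π.re - x)
  rw [hqy] at this
  exact this.of_mul_right_left

theorem norm_intCast_add_two_mul :
    ((x : ℤ[i]) + 2 * π).norm = 2 * (x * (x + 2 * π.re)) + q * y ^ 2 := by
  rw [norm_eq_sq_add_sq] at hxy ⊢
  rw [re_intCast_add_two_mul, im_intCast_add_two_mul]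
  linear_combination hxy

theorem quarticSymbol_add_two_mul_sq (hx : Odd x) (hy : Odd y)
    (hcop : IsCoprime π.im (x + 2 * π.re)) :
    quarticSymbol y (x + 2 * π) ^ 2 = quarticSymbol y π := by
  have hcongr : (y : ℤ[i]) ∣ (x + 2 * π) ^ 2 - ((2 * 2 * (x + 2 * π.re) : ℤ) : ℤ[i]) * π := by
    have h1 : (4 : ℤ[i]) * (π * star π) = x ^ 2 + q * y ^ 2 := by
      rw [← Zsqrtd.norm_eq_mul_conj]
      exact_mod_cast congrArg (Int.cast (R := ℤ[i])) hxy
    have h2 : π + star π = 2 * π.re := by ext <;> simp [two_mul]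
    refine ⟨-q * y, ?_⟩
    push_cast
    linear_combination -h1 + 4 * π * h2
  have htwo : IsCoprime y 2 := Int.isCoprime_two_right.2 hy
  have hA := (isCoprime_re_of_four_mul_norm_eq hxy hx hcop).symm
  rw [← map_pow, quarticSymbol_congr hcongr, map_mul,
    quarticSymbol_intCast_intCast hy ((htwo.mul_right htwo).mul_right hA), one_mul]

theorem quarticSymbol_intCast_mul_quarticSymbol_eq (hπ : Odd π.norm) (hq : q ≡ 3 [ZMOD 4])
    (hx : Odd x) (hy : y ≡ 1 [ZMOD 4]) (hcop : IsCoprime π.im (x + 2 * π.re)) :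
    quarticSymbol q (x + 2 * π) * quarticSymbol y π =
      imagPow ((x + 2 * π.re) * π.im + (x + 2 * π.re) ^ 2 / 4) * quarticSymbol x π := by
  have hω := odd_intCast_add_two_mul (π := π) hx
  have hyodd : Odd y := Int.odd_iff.2 (by rw [Int.ModEq] at hy; omega)
  have hneg : -q ≡ 1 [ZMOD 4] := by rw [Int.ModEq] at hq ⊢; omega
  have hcongr : (x : ℤ[i]) + 2 * π ∣
      ((-q : ℤ) : ℤ[i]) * (y : ℤ[i]) ^ 2 - 2 * ((x * (x + 2 * π.re) : ℤ) : ℤ[i]) := by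
    have h := dvd_norm ((x : ℤ[i]) + 2 * π)
    rw [norm_intCast_add_two_mul hxy, ← dvd_neg] at h
    convert h using 1
    push_cast
    ring
  calc
    _ = quarticSymbol (x + 2 * π) (((-q : ℤ) : ℤ[i]) * (y : ℤ[i]) ^ 2) := by
      rw [map_mul, map_pow, quarticSymbol_intCast_of_modEq_one hω hneg,
        quarticSymbol_intCast_of_modEq_one hω hy, Int.cast_neg, quarticSymbol_neg,
        quarticSymbol_add_two_mul_sq hxy hx hyodd hcop]
    _ = _ := by
      rw [quarticSymbol_congr hcongr, map_mul, quarticSymbol_two_intCast_add_two_mul hx hcop,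
        quarticSymbol_intCast_add_two_mul_mul_re hπ hx hcop, imagPow_add, mul_assoc]

end

end NormEquation

section InertPrime

variable {q : ℕ} (hq : q.Prime) (hq4 : q % 4 = 3)
include hq hq4

theorem natPrime_dvd_quarticSymbol_mul_pow_sub (α : ℤ[i]) :
    (q : ℤ[i]) ∣ quarticSymbol q α * α ^ ((q + 1) / 4) - star α ^ ((q + 1) / 4) := by
  have := Fact.mk hq
  have hprime := GaussianInt.prime_of_nat_prime_of_mod_four_eq_three q hq4
  have hq2 := PrimeNotDvdTwo.of_odd hprime (Nat.odd_iff.2 (by omega)).natCast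
  have hsymbol := (hq2.symbol_pow_five_and_dvd α).2
  rw [← quarticSymbol_of_prime hprime, natAbs_norm_natCast_div_four hq4] at hsymbol
  have hstar := (natPrime_dvd_pow_sub_star hq hq4 α).trans
    (sub_dvd_pow_sub_pow _ _ ((q + 1) / 4))
  have hpow : (α ^ q) ^ ((q + 1) / 4) = α ^ ((q - 1) * ((q + 1) / 4)) * α ^ ((q + 1) / 4) := by
    rw [← pow_mul, ← pow_add, ← add_one_mul, Nat.sub_add_cancel hq.one_le]
  rw [hpow] at hstar
  convert dvd_sub hstar (hsymbol.mul_right (α ^ ((q + 1) / 4))) using 1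
  ring

theorem quarticSymbol_natPrime_intCast_add_two_mul {x : ℤ} {π u : ℤ[i]} (hx : ¬ (q : ℤ) ∣ x)
    (hω : ¬ (q : ℤ[i]) ∣ x + 2 * π) (hN : (q : ℤ) ∣ x ^ 2 - 4 * π.norm) (hu : u ^ 5 = u)
    (h : (q : ℤ[i]) ∣ (2 * star π) ^ ((q + 1) / 4) - x ^ ((q + 1) / 4) * u) :
    quarticSymbol q (x + 2 * π) = u := by
  have := Fact.mk hq
  have hprime := GaussianInt.prime_of_nat_prime_of_mod_four_eq_three q hq4
  have hq2 := PrimeNotDvdTwo.of_odd hprime (Nat.odd_iff.2 (by omega)).natCast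
  refine hq2.eq_of_pow_five_eq_self (quarticSymbol_pow_five _ _) hu ?_
  have hx' : ¬ (q : ℤ[i]) ∣ x := by rwa [← Int.cast_natCast, Zsqrtd.intCast_dvd_intCast]
  have hstar : (q : ℤ[i]) ∣ x * star ((x : ℤ[i]) + 2 * π) - 2 * star π * (x + 2 * π) := by
    have hN' := Int.cast_dvd_cast (α := ℤ[i]) _ _ hN
    convert hN' using 1
    · rw [Int.cast_natCast]
    · push_cast
      rw [Zsqrtd.norm_eq_mul_conj, star_add, star_mul, star_intCast, star_ofNat]
      ring
  set ω : ℤ[i] := x + 2 * π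
  set k := (q + 1) / 4
  have hdvd : (q : ℤ[i]) ∣ x ^ k * ω ^ k * (quarticSymbol q ω - u) := by
    have hω_star := natPrime_dvd_quarticSymbol_mul_pow_sub hq hq4 ω
    convert dvd_add (dvd_add (hω_star.mul_left (x ^ k))
      (hstar.trans (sub_dvd_pow_sub_pow _ _ k))) (h.mul_left (ω ^ k)) using 1
    simp only [mul_pow]
    ring
  refine (hprime.dvd_or_dvd hdvd).resolve_left fun hd => ?_
  exact (hprime.dvd_or_dvd hd).elim (hx' ∘ hprime.dvd_of_dvd_pow) (hω ∘ hprime.dvd_of_dvd_pow)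

theorem imagPow_mul_quarticSymbol_eq {x y n : ℤ} {π : ℤ[i]}
    (hxy : 4 * π.norm = x ^ 2 + q * y ^ 2) (hπ : Odd π.norm) (hqx : ¬ (q : ℤ) ∣ x) (hx : Odd x)
    (hy : y ≡ 1 [ZMOD 4]) (hcop : IsCoprime π.im (x + 2 * π.re))
    (h : (q : ℤ[i]) ∣ (2 * star π) ^ ((q + 1) / 4) - x ^ ((q + 1) / 4) * imagPow n) :
    imagPow n * quarticSymbol y π =
      imagPow ((x + 2 * π.re) * π.im + (x + 2 * π.re) ^ 2 / 4) * quarticSymbol x π := by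
  have hω : ¬ (q : ℤ[i]) ∣ x + 2 * π := by
    intro hd
    rw [← Int.cast_natCast, Zsqrtd.intCast_dvd] at hd
    exact (Nat.prime_iff_prime_int.1 hq).not_isUnit
      ((isCoprime_re_im_intCast_add_two_mul hx hcop).isUnit_of_dvd' hd.1 hd.2)
  have hu : imagPow n ^ 5 = imagPow n := by rw [pow_succ, imagPow_pow_four, one_mul]
  rw [← quarticSymbol_intCast_mul_quarticSymbol_eq hxy hπ (by rw [Int.ModEq]; omega) hx hy hcop,
    Int.cast_natCast, quarticSymbol_natPrime_intCast_add_two_mul hq hq4 hqx hω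
      ⟨-y ^ 2, by linear_combination -hxy⟩ hu h]

end InertPrime

theorem dvd_of_gaussianCongr {q : ℕ} {x m : ℤ} {π : ℤ[i]} {k : ℕ} (hx : x ≠ 0)
    (h : GaussianCongr q ((2 * ((π.re : ℂ) - π.im * Complex.I) / x) ^ k) (Complex.I ^ m)) :
    (q : ℤ[i]) ∣ (2 * star π) ^ k - x ^ k * imagPow m := by
  obtain ⟨t, ht, γ, hγ⟩ := h
  have hI : GaussianInt.toComplex (imagPow m) = Complex.I ^ m := by
    rw [map_imagPow]
    simp [imagUnit, GaussianInt.toComplex_def]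
  have hstar : GaussianInt.toComplex (star π) = π.re - π.im * Complex.I := by
    simp [GaussianInt.toComplex_def, sub_eq_add_neg]
  have hxC : (x : ℂ) ≠ 0 := by exact_mod_cast hx
  have hclear : (t : ℤ[i]) * ((2 * star π) ^ k - x ^ k * imagPow m) = q * (γ * x ^ k) := by
    rw [← GaussianInt.toComplex_inj]
    simp only [map_mul, map_sub, map_pow, map_intCast, map_natCast, map_ofNat, hI, hstar]
    rw [div_pow] at hγ
    field_simp at hγ
    push_cast at hγ
    linear_combination hγ
  have hcop := isCoprime_intCast_iff.2 ht
  rw [Int.cast_natCast] at hcop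
  exact hcop.symm.dvd_of_dvd_mul_left ⟨_, hclear⟩

theorem eq_imagPow_sub_mul {m n : ℤ} {α β : ℤ[i]} (h : imagPow m * α = imagPow n * β) :
    β = imagPow (m - n) * α := by
  refine mul_left_cancel₀ (imagPow_ne_zero n) ?_
  rw [← h, ← mul_assoc, ← imagPow_add, add_sub_cancel]

theorem sq_add_two_mul_ediv_four (x a : ℤ) : (x + 2 * a) ^ 2 / 4 = x ^ 2 / 4 + x * a + a ^ 2 := by
  rw [show (x + 2 * a) ^ 2 = x ^ 2 + 4 * (x * a + a ^ 2) by ring,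
    Int.add_mul_ediv_left _ _ four_ne_zero, add_assoc]

theorem im_modEq_two_mul_norm_div_four {π : ℤ[i]} (hπ : Odd π) :
    π.im ≡ 2 * (π.norm / 4) [ZMOD 4] := by
  obtain ⟨⟨a, ha⟩, b, hb⟩ := odd_iff.1 hπ
  have hP : π.norm / 4 = a * (a + 1) + b ^ 2 := by
    rw [norm_eq_sq_add_sq, ha, hb]
    ring_nf
    omega
  obtain ⟨s, hs⟩ := Int.even_mul_succ_self a
  obtain ⟨t, ht⟩ := Int.even_mul_succ_self b
  rw [hP, hs, hb]
  exact Int.modEq_iff_dvd.2 ⟨s + t - b, by linear_combination 2 * ht⟩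

-- On the left is the exponent of `i` produced by reciprocity for `x` and `π` together with the
-- value of the symbol modulo `q`; in `rotated_reciprocity_exponent_modEq` the latter is taken
-- at `-i π`.
theorem reciprocity_exponent_modEq {π : ℤ[i]} {x m : ℤ} (hπ : Odd π)
    (hre : π.re ≡ 1 [ZMOD 4]) (hx : Odd x) :
    (x - 1) * (π.norm / 4) + (m - ((x + 2 * π.re) * π.im + (x + 2 * π.re) ^ 2 / 4)) ≡
      m + x ^ 2 / 4 + (x + 1) * (1 - π.norm / 4) [ZMOD 4] := by
  obtain ⟨s, hs⟩ := even_sq_div_four_of_odd hx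
  obtain ⟨r, hr⟩ := hre.symm.dvd
  obtain ⟨t, ht⟩ := (im_modEq_two_mul_norm_div_four hπ).dvd
  obtain ⟨k, rfl⟩ := hx
  rw [sq_add_two_mul_ediv_four, hs]
  refine Int.modEq_iff_dvd.2 ⟨s + π.norm / 4 * (1 + 4 * r) - (2 * k + 1 + 2 * π.re) * t + k + 1 +
    r * (2 * k + 2 + π.re), ?_⟩
  linear_combination -(2 * k + 1 + 2 * π.re) * ht + (4 * (π.norm / 4) + 2 * k + 2 + π.re) * hr

theorem quarter_add_sq_div_four_modEq {p q x y : ℤ} (hxy : 4 * p = x ^ 2 + q * y ^ 2)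
    (hp : p ≡ 1 [ZMOD 4]) (hq : q ≡ 3 [ZMOD 4]) (hx : Odd x) (hy : Odd y) :
    (q + 1) / 4 + y ^ 2 / 4 ≡ 1 - x ^ 2 / 4 [ZMOD 4] := by
  obtain ⟨t, ht⟩ := even_sq_div_four_of_odd hy
  obtain ⟨k, hk⟩ : ∃ k, q = 4 * k - 1 := ⟨(q + 1) / 4, by rw [Int.ModEq] at hq; omega⟩
  have hx2 : x ^ 2 = 4 * (x ^ 2 / 4) + 1 := by
    have := Int.eight_dvd_sq_sub_one_of_odd hx
    omega
  have hy2 : y ^ 2 = 4 * (t + t) + 1 := by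
    have := Int.eight_dvd_sq_sub_one_of_odd hy
    omega
  have hp' : p = x ^ 2 / 4 + 4 * k * (t + t) + k - (t + t) := by
    rw [hk, hy2] at hxy
    linarith
  obtain ⟨r, hr⟩ := hp.symm.dvd
  rw [ht, show (q + 1) / 4 = k by omega]
  exact Int.modEq_iff_dvd.2 ⟨2 * k * t - t - r, by linear_combination hp' - hr⟩

theorem rotated_reciprocity_exponent_modEq {π : ℤ[i]} {q x y m : ℤ} (hπ : Odd π)
    (hxy : 4 * π.norm = x ^ 2 + q * y ^ 2) (hre : π.re ≡ 1 [ZMOD 4]) (hq : q ≡ 3 [ZMOD 4])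
    (hx : Odd x) (hy : Odd y) :
    (x - 1) * (π.norm / 4) + ((q + 1) / 4 + m + y ^ 2 / 4 -
        ((x + 2 * π.im) * -π.re + (x + 2 * π.im) ^ 2 / 4 + x ^ 2 / 4)) ≡
      m + x ^ 2 / 4 + (x + 1) * (1 - π.norm / 4) [ZMOD 4] := by
  obtain ⟨r, hr⟩ := hre.symm.dvd
  obtain ⟨t, ht⟩ := (im_modEq_two_mul_norm_div_four hπ).dvd
  obtain ⟨u, hu⟩ := (quarter_add_sq_div_four_modEq hxy (norm_mod_four_eq_one
    (isCoprime_two_of_odd hπ)) hq hx hy).dvd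
  rw [sq_add_two_mul_ediv_four]
  refine Int.modEq_iff_dvd.2 ⟨x ^ 2 / 4 + u - x * t - x * r +
    (π.norm / 4 - 2 * t) * (π.norm / 4 - 2 * t - π.re), ?_⟩
  linear_combination hu - x * hr - (x + π.im + 2 * (π.norm / 4 - 2 * t) - 2 * π.re) * ht

theorem re_neg_imagUnit_mul (π : ℤ[i]) : (-imagUnit * π).re = π.im := by
  simp [imagUnit]

theorem im_neg_imagUnit_mul (π : ℤ[i]) : (-imagUnit * π).im = -π.re := by
  simp [imagUnit]

theorem norm_neg_imagUnit_mul (π : ℤ[i]) : (-imagUnit * π).norm = π.norm := by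
  rw [norm_eq_sq_add_sq, norm_eq_sq_add_sq, re_neg_imagUnit_mul, im_neg_imagUnit_mul]
  ring

theorem quarticSymbol_intCast_neg_imagUnit_mul {a : ℤ} (ha : Odd a) (π : ℤ[i]) :
    quarticSymbol a (-imagUnit * π) = imagPow (a ^ 2 / 4) * quarticSymbol a π := by
  have hneg : -imagUnit * π = ((-1 : ℤ) : ℤ[i]) * imagUnit * π := by
    push_cast
    ring
  rw [hneg, map_mul, map_mul, quarticSymbol_intCast_intCast ha isCoprime_one_right.neg_right,
    one_mul, quarticSymbol_intCast_imagUnit ha]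

theorem dvd_neg_imagUnit_mul {α π : ℤ[i]} {x m : ℤ} {k : ℕ}
    (h : α ∣ (2 * star π) ^ k - x ^ k * imagPow m) :
    α ∣ (2 * star (-imagUnit * π)) ^ k - x ^ k * imagPow (k + m) := by
  convert h.mul_left (imagUnit ^ k) using 1
  rw [star_mul, star_neg, star_imagUnit, neg_neg, ← mul_assoc, mul_pow, imagPow_add,
    imagPow_natCast]
  ring

-- Multiplication by `-i` exchanges the real and imaginary parts of `π` up to sign, which turns the
-- first coprimality hypothesis into the second.
theorem quarticSymbol_intCast_eq_imagPow_mul {q : ℕ} {x y m : ℤ} {π : ℤ[i]} (hq : q.Prime)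
    (hq4 : q % 4 = 3) (hxy : 4 * π.norm = x ^ 2 + q * y ^ 2) (hqx : ¬ (q : ℤ) ∣ x) (hx : Odd x)
    (hy : y ≡ 1 [ZMOD 4]) (hπ : Odd π) (hre : π.re ≡ 1 [ZMOD 4])
    (hcop : IsCoprime π.re (x + 2 * π.im) ∨ IsCoprime π.im (x + 2 * π.re))
    (h : (q : ℤ[i]) ∣ (2 * star π) ^ ((q + 1) / 4) - x ^ ((q + 1) / 4) * imagPow m) :
    quarticSymbol π x =
      imagPow (m + x ^ 2 / 4 + (x + 1) * (1 - π.norm / 4)) * quarticSymbol π y := by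
  have hnorm : Odd π.norm := isCoprime_two_iff.1 (isCoprime_two_of_odd hπ)
  rw [quarticSymbol_intCast hπ hx, quarticSymbol_intCast_of_modEq_one hπ hy]
  rcases hcop with hcop | hcop
  · have hyodd : Odd y := Int.odd_iff.2 (by rw [Int.ModEq] at hy; omega)
    have hrot := imagPow_mul_quarticSymbol_eq (π := -imagUnit * π) hq hq4
      (by rwa [norm_neg_imagUnit_mul]) (by rwa [norm_neg_imagUnit_mul]) hqx hx hy
      (by rw [re_neg_imagUnit_mul, im_neg_imagUnit_mul]; exact hcop.neg_left)
      (dvd_neg_imagUnit_mul h)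
    rw [quarticSymbol_intCast_neg_imagUnit_mul hyodd, quarticSymbol_intCast_neg_imagUnit_mul hx,
      ← mul_assoc, ← mul_assoc, ← imagPow_add, ← imagPow_add, re_neg_imagUnit_mul,
      im_neg_imagUnit_mul] at hrot
    rw [eq_imagPow_sub_mul hrot, ← mul_assoc, ← imagPow_add]
    congr 1
    exact imagPow_congr (rotated_reciprocity_exponent_modEq hπ hxy hre (by rw [Int.ModEq]; omega)
      hx hyodd)
  · rw [eq_imagPow_sub_mul (imagPow_mul_quarticSymbol_eq hq hq4 hxy hnorm hqx hx hy hcop h),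
      ← mul_assoc, ← imagPow_add, imagPow_congr (reciprocity_exponent_modEq hπ hre hx)]

theorem symbol_exponent_modEq_of_even {x P : ℤ} (m : ℤ) (hx : Odd x) (hP : Even P) :
    m + x ^ 2 / 4 + (x + 1) * (1 - P) ≡ m + 2 * (x / 4 + 1) [ZMOD 4] := by
  obtain ⟨r, rfl⟩ := hP
  obtain ⟨a, rfl | rfl⟩ : ∃ a, x = 4 * a + 1 ∨ x = 4 * a + 3 :=
    ⟨x / 4, by rw [Int.odd_iff] at hx; omega⟩
  · rw [show (4 * a + 1) ^ 2 / 4 = 4 * a ^ 2 + 2 * a by ring_nf; omega,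
      show (4 * a + 1) / 4 = a by omega]
    exact Int.modEq_iff_dvd.2 ⟨(2 * a + 1) * r - a ^ 2 - a, by ring⟩
  · rw [show (4 * a + 3) ^ 2 / 4 = 4 * a ^ 2 + 6 * a + 2 by ring_nf; omega,
      show (4 * a + 3) / 4 = a by omega]
    exact Int.modEq_iff_dvd.2 ⟨(2 * a + 2) * r - a ^ 2 - 2 * a - 1, by ring⟩

theorem symbol_exponent_modEq_of_odd {x P : ℤ} (m : ℤ) (hx : Odd x) (hP : Odd P) :
    m + x ^ 2 / 4 + (x + 1) * (1 - P) ≡ m + 2 * ((x ^ 2 - 1) / 8) [ZMOD 4] := by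
  have hX : x ^ 2 / 4 = 2 * ((x ^ 2 - 1) / 8) := by
    have := Int.eight_dvd_sq_sub_one_of_odd hx
    omega
  obtain ⟨r, rfl⟩ := hP
  obtain ⟨k, rfl⟩ := hx
  rw [hX]
  exact Int.modEq_iff_dvd.2 ⟨(k + 1) * r, by ring⟩

theorem intCast_pow_eq_of_quarticSymbol_eq {p : ℕ} [Fact p.Prime] {π : ℤ[i]} (hN : π.norm = p)
    (hp4 : p % 4 = 1) {x y n m e : ℤ}
    (h : quarticSymbol π x = imagPow n * quarticSymbol π y) (hn : n ≡ m + 2 * e [ZMOD 4]) :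
    (x : ZMod p) ^ (p / 4) =
      (-1) ^ e * ((π.im : ZMod p) / π.re) ^ m * (y : ZMod p) ^ (p / 4) := by
  have hsq : ((π.im : ZMod p) / π.re) ^ (2 : ℤ) = -1 := by
    rw [← residueHom_imagUnit hN, ← map_imagPow, imagPow_two, map_neg, map_one]
  have hne : (π.im : ZMod p) / π.re ≠ 0 := by
    intro h0
    rw [h0] at hsq
    norm_num at hsq
  have hθ := congrArg (residueHom hN) h
  rw [imagPow_congr hn, map_mul, residueHom_quarticSymbol hN hp4, residueHom_quarticSymbol hN hp4,
    map_intCast, map_intCast, map_imagPow, residueHom_imagUnit, zpow_add₀ hne, zpow_mul, hsq] at hθ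
  rw [hθ, mul_comm ((-1) ^ e)]

theorem intCast_ne_zero_of_sq_le {p : ℕ} (hp : 4 < p) {a : ℤ} (ha : a ≠ 0)
    (h : a ^ 2 ≤ 4 * p) : (a : ZMod p) ≠ 0 := by
  rw [ne_eq, ZMod.intCast_zmod_eq_zero_iff_dvd]
  intro hd
  have hle := Int.le_of_dvd (abs_pos.2 ha) ((dvd_abs _ _).2 hd)
  rw [← sq_abs] at h
  nlinarith

theorem intCast_ne_zero_of_four_mul_eq {p q : ℕ} (hp : 4 < p) (hq : q ≠ 0) {x y : ℤ}
    (hxy : 4 * (p : ℤ) = x ^ 2 + q * y ^ 2) (hx : x ≠ 0) (hy : y ≠ 0) :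
    (x : ZMod p) ≠ 0 ∧ (y : ZMod p) ≠ 0 := by
  have hqy : y ^ 2 ≤ q * y ^ 2 :=
    le_mul_of_one_le_left (sq_nonneg y) (by exact_mod_cast Nat.one_le_iff_ne_zero.2 hq)
  constructor
  · exact intCast_ne_zero_of_sq_le hp hx (by linarith [sq_nonneg y])
  · exact intCast_ne_zero_of_sq_le hp hy (by linarith [sq_nonneg x])

theorem odd_of_odd_norm_of_odd_re {π : ℤ[i]} (hN : Odd π.norm) (hre : Odd π.re) : Odd π := by
  rw [norm_eq_sq_add_sq, Int.odd_add, Int.odd_pow' two_ne_zero, Int.even_pow' two_ne_zero] at hN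
  exact odd_iff.2 ⟨hre, hN.1 hre⟩

theorem odd_of_four_mul_eq {p q x y : ℤ} (hxy : 4 * p = x ^ 2 + q * y ^ 2) (hq : Odd q)
    (hy : Odd y) : Odd x := by
  have heven : Even (x ^ 2 + q * y ^ 2) := ⟨2 * p, by linarith⟩
  rw [← Int.odd_pow' two_ne_zero]
  exact (Int.even_add'.1 heven).2 (hq.mul hy.pow)

theorem not_dvd_of_four_mul_eq {p q : ℕ} (hp : p.Prime) (hq : q.Prime) (hpq : q ≠ p) (hq2 : q ≠ 2)
    {x y : ℤ} (hxy : 4 * (p : ℤ) = x ^ 2 + q * y ^ 2) : ¬ (q : ℤ) ∣ x := by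
  intro hd
  have hdvd : (q : ℤ) ∣ (2 ^ 2 * p : ℕ) := by
    rw [show ((2 ^ 2 * p : ℕ) : ℤ) = x * x + q * y ^ 2 by push_cast; linarith]
    exact dvd_add (hd.mul_right x) (dvd_mul_right _ _)
  rcases hq.dvd_mul.1 (Int.natCast_dvd_natCast.1 hdvd) with h | h
  · exact hq2 ((Nat.prime_dvd_prime_iff_eq hq Nat.prime_two).1 (hq.dvd_of_dvd_pow h))
  · exact hpq ((Nat.prime_dvd_prime_iff_eq hq hp).1 h)

theorem neg_natCast_eq_div_sq {p q : ℕ} [Fact p.Prime] {x y : ℤ}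
    (hxy : 4 * (p : ℤ) = x ^ 2 + q * y ^ 2) (hy : (y : ZMod p) ≠ 0) :
    -(q : ZMod p) = ((x : ZMod p) / y) ^ 2 := by
  have h := congrArg (Int.cast (R := ZMod p)) hxy
  push_cast at h
  rw [ZMod.natCast_self] at h
  field_simp
  linear_combination h

section Field

variable {F : Type*} [Field F] {u v s : F} {k : ℕ}

theorem div_sq_pow_eq_of_pow_even (hv : v ≠ 0) (h : u ^ (2 * k) = s * v ^ (2 * k)) :
    ((u / v) ^ 2) ^ k = s := by
  rw [← pow_mul, div_pow, h, mul_div_cancel_right₀ _ (pow_ne_zero _ hv)]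

theorem div_sq_pow_eq_of_pow_odd (hu : u ≠ 0) (hv : v ≠ 0)
    (h : u ^ (2 * k + 1) = s * v ^ (2 * k + 1)) : ((u / v) ^ 2) ^ k = s * (v / u) := by
  rw [← div_sq_pow_eq_of_pow_even hv (k := k) (s := s * (v / u))]
  field_simp
  rw [← pow_succ, h]
  ring

end Field

end QuarticReciprocity

open QuarticReciprocity

theorem theorem3p3 (p q : ℕ) [Fact p.Prime] [Fact q.Prime]
    (hp : p ≡ 1 [MOD 4]) (hq : q ≡ 3 [MOD 8])
    (c d x y m : ℤ)
    (hcd : (p : ℤ) = c ^ 2 + d ^ 2)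
    (hxy : 4 * (p : ℤ) = x ^ 2 + (q : ℤ) * y ^ 2)
    (hc : c ≡ 1 [ZMOD 4]) (hy : y ≡ 1 [ZMOD 4])
    (hgcd : Int.gcd c (x + 2 * d) = 1 ∨ Int.gcd d (x + 2 * c) = 1)
    (hm : GaussianCongr (q : ℤ)
      ((2 * ((c : ℂ) - (d : ℂ) * Complex.I) / (x : ℂ)) ^ ((q + 1) / 4)) (Complex.I ^ m)) :
    (p ≡ 1 [MOD 8] →
      (-(q : ZMod p)) ^ (p / 8) =
        (-1 : ZMod p) ^ (x / 4 + 1) * ((d : ZMod p) / (c : ZMod p)) ^ m) ∧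
    (p ≡ 5 [MOD 8] →
      (-(q : ZMod p)) ^ (p / 8) =
        (-1 : ZMod p) ^ ((x ^ 2 - 1) / 8) * ((d : ZMod p) / (c : ZMod p)) ^ m *
          ((y : ZMod p) / (x : ZMod p))) := by
  rw [Nat.ModEq] at hp hq
  have hp4 : 4 < p := by have := (Fact.out : p.Prime).two_le; omega
  have hc' : Odd c := Int.odd_iff.2 (by rw [Int.ModEq] at hc; omega)
  have hy' : Odd y := Int.odd_iff.2 (by rw [Int.ModEq] at hy; omega)
  have hx : Odd x := odd_of_four_mul_eq hxy (Int.odd_iff.2 (by omega)) hy'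
  have hx' : x ≠ 0 := by rintro rfl; simp at hx
  obtain ⟨hx0, hy0⟩ := intCast_ne_zero_of_four_mul_eq hp4 (by omega) hxy hx'
    (by rintro rfl; simp at hy')
  have hN : (⟨c, d⟩ : GaussianInt).norm = p := by rw [norm_eq_sq_add_sq, hcd]
  have hπ : Odd (⟨c, d⟩ : GaussianInt) :=
    odd_of_odd_norm_of_odd_re (by rw [hN, Int.odd_iff]; omega) hc'
  have hsymbol := quarticSymbol_intCast_eq_imagPow_mul Fact.out (by omega) (hN ▸ hxy)
    (not_dvd_of_four_mul_eq Fact.out Fact.out (by omega) (by omega) hxy) hx hy hπ hc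
    (by simpa only [Int.isCoprime_iff_gcd_eq_one] using hgcd)
    (dvd_of_gaussianCongr hx' hm)
  rw [hN] at hsymbol
  rw [neg_natCast_eq_div_sq hxy hy0]
  refine ⟨fun h8 => div_sq_pow_eq_of_pow_even hy0 ?_, fun h8 => div_sq_pow_eq_of_pow_odd hx0 hy0 ?_⟩
  · rw [Nat.ModEq] at h8
    rw [show 2 * (p / 8) = p / 4 by omega]
    exact intCast_pow_eq_of_quarticSymbol_eq hN hp hsymbol
      (symbol_exponent_modEq_of_even m hx (Int.even_iff.2 (by omega)))
  · rw [Nat.ModEq] at h8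
    rw [show 2 * (p / 8) + 1 = p / 4 by omega]
    exact intCast_pow_eq_of_quarticSymbol_eq hN hp hsymbol
      (symbol_exponent_modEq_of_odd m hx (Int.odd_iff.2 (by omega)))
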